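/- Let $\langle\cdot,\cdot\rangle$ be the standard inner product on $\mathbb{R}^n$, extended to the Hermitian form on $\mathbb{C}^n$ that is antilinear in the first variable and linear in the second. Let $\Phi\subset\mathbb{R}^n$ be a (reduced, crystallographic) root system of rank $n$: a finite set spanning $\mathbb{R}^n$ such that for all $v,w\in\Phi$ and $\lambda\in\mathbb{R}$ one has $\lambda v\in\Phi\iff\lambda=\pm1$, $\;w-2\frac{\langle v,w\rangle}{\langle v,v\rangle}v\in\Phi$ and $2\frac{\langle v,w\rangle}{\langle v,v\rangle}\in\mathbb{Z}$. Let $W_\Phi$ be the Weyl group, generated by the orthogonal reflections in the roots. Given a linear functional $\phi$ vanishing at no root, a root $v$ is positive if $\phi(v)>0$, and a positive root is simple if it is not the sum of two distinct positive roots. A choice of fundamental weights is a family $\omega_1,\dots,\omega_n$ dual to the coroots $\alpha_k^\vee=2\alpha_k/\langle\alpha_k,\alpha_k\rangle$ of an enumeration $\alpha_1,\dots,\alpha_n$ of the simple roots for some such $\phi$. The generalized cosine $\Psi_\Phi:\mathbb{C}^n\to\mathbb{C}^n$ has coordinates $$\psi_k(x)=\sum_{r\in W_\Phi\omega_k}\exp\big(2\pi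 i\langle r,x\rangle\big),\qquad 1\le k\le n .$$ Put $$\mathcal{H}_\Phi=\bigcup_{v\in\Phi,\ \ell\in\mathbb{Z}}\{x\in\mathbb{C}^n:\langle v,x\rangle=\ell\},\qquad \mathcal{D}_\Phi=\Psi_\Phi(\mathcal{H}_\Phi).$$ For $f:\mathbb{C}^n\to\mathbb{C}^n$ holomorphic, the critical locus $\mathcal{C}_f$ is the set of points where the derivative of $f$ is singular, the post-critical locus is $\mathcal{P}_f=\bigcup_{k\ge1}f^k(\mathcal{C}_f)$, and $f$ is post-critically finite if $\mathcal{C}_f\ne\mathbb{C}^n$ and $\mathcal{P}_f$ is a closed, proper (algebraic, not necessarily irreducible) subvariety of $\mathbb{C}^n$. **Lemma.** Every root system $\Phi$ of rank $n$ has a choice of fundamental weights, and for every such choice: 1. $\Psi_\Phi$ is holomorphic and its critical locus is $\mathcal{H}_\Phi$. 2. For every integer $d\ge2$ there is exactly one map $T_{\Phi,d}:\mathbb{C}^n\to\mathbb{C}^n$ with $T_{\Phi,d}(\Psi_\Phi(x))=\Psi_\Phi(d\,x)$ for all $x\in\mathbb{C}^n$ (the Chebyshev-like map). It is a polynomial map,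 it is post-critically finite, and its post-critical locus is exactly $\mathcal{D}_\Phi$. In particular, the post-critical locus does not depend on $d$. 3. $\mathcal{D}_\Phi$ depends only on $\Phi$: replacing the chosen fundamental weights by any other choice changes $\mathcal{D}_\Phi$ only by a permutation of the coordinates of $\mathbb{C}^n$. -/

import Mathlib

open Set
open scoped BigOperators

namespace ChebyshevLike

/-- Euclidean `n`-space with its standard inner product. -/
abbrev RSpace (n : ℕ) : Type := EuclideanSpace ℝ (Fin n)

/-- Hermitian `n`-space; `inner ℂ v w` is antilinear in `v` and linear in `w`. -/
abbrev CSpace (n : ℕ) : Type := EuclideanSpace ℂ (Fin n)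

/-- The inclusion of real `n`-space in complex `n`-space. -/
def toComplex {n : ℕ} (v : RSpace n) : CSpace n := WithLp.toLp 2 fun i => (v i : ℂ)

/-- Reduced crystallographic root systems of rank `n` in Euclidean `n`-space. -/
structure IsRootSystem {n : ℕ} (Φ : Set (RSpace n)) : Prop where
  finite : Φ.Finite
  span_eq_top : Submodule.span ℝ Φ = ⊤
  smul_mem_iff : ∀ v ∈ Φ, ∀ c : ℝ, c • v ∈ Φ ↔ c = 1 ∨ c = -1
  reflection_mem : ∀ v ∈ Φ, ∀ w ∈ Φ, w - (2 * inner ℝ v w / inner ℝ v v) • v ∈ Φ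
  integral : ∀ v ∈ Φ, ∀ w ∈ Φ, ∃ m : ℤ, 2 * inner ℝ v w / inner ℝ v v = (m : ℝ)

/-- The coroot `2 v / ⟨v, v⟩`. -/
noncomputable def coroot {n : ℕ} (v : RSpace n) : RSpace n := (2 / inner ℝ v v) • v

/-- The Weyl group: the group generated by the orthogonal reflections across the hyperplanes
perpendicular to the roots. -/
noncomputable def weylGroup {n : ℕ} (Φ : Set (RSpace n)) : Subgroup (RSpace n ≃ₗᵢ[ℝ] RSpace n) :=
  Subgroup.closure {g | ∃ v ∈ Φ, g = (Submodule.span ℝ {v})ᗮ.reflection}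

/-- The orbit of a vector under the Weyl group. -/
def weylOrbit {n : ℕ} (Φ : Set (RSpace n)) (u : RSpace n) : Set (RSpace n) :=
  {r | ∃ w ∈ weylGroup Φ, r = w u}

/-- The roots that are positive relative to a linear functional `φ`. -/
def positiveRoots {n : ℕ} (Φ : Set (RSpace n)) (φ : RSpace n →ₗ[ℝ] ℝ) : Set (RSpace n) :=
  {v | v ∈ Φ ∧ 0 < φ v}

/-- The positive roots that are not a sum of two distinct positive roots. -/
def simpleRoots {n : ℕ} (Φ : Set (RSpace n)) (φ : RSpace n →ₗ[ℝ] ℝ) : Set (RSpace n) :=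
  {a | a ∈ positiveRoots Φ φ ∧
    ¬ ∃ v ∈ positiveRoots Φ φ, ∃ w ∈ positiveRoots Φ φ, v ≠ w ∧ a = v + w}

/-- `ω` is a choice of fundamental weights for `Φ`: for some functional that vanishes at no root
and some enumeration `α` of the corresponding simple roots, `ω` is dual to the simple coroots. -/
def IsFundamentalWeights {n : ℕ} (Φ : Set (RSpace n)) (ω : Fin n → RSpace n) : Prop :=
  ∃ φ : RSpace n →ₗ[ℝ] ℝ, (∀ v ∈ Φ, φ v ≠ 0) ∧
    ∃ α : Fin n → RSpace n, Function.Injective α ∧ range α = simpleRoots Φ φ ∧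
      ∀ j k : Fin n, inner ℝ (ω j) (coroot (α k)) = if j = k then (1 : ℝ) else 0

/-- The Weyl group of a root system permutes the roots. -/
theorem weylGroup_apply_mem {n : ℕ} {Φ : Set (RSpace n)} (h : IsRootSystem Φ)
    {g : RSpace n ≃ₗᵢ[ℝ] RSpace n} (hg : g ∈ weylGroup Φ) : ∀ v ∈ Φ, g v ∈ Φ := by
  have hr : ∀ v ∈ Φ, ∀ w ∈ Φ, (Submodule.span ℝ {v})ᗮ.reflection w ∈ Φ := by
    intro v hv w hw
    have h1 := h.reflection_mem v hv w hw
    have h2 : (Submodule.span ℝ {v})ᗮ.reflection w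
        = w - (2 * inner ℝ v w / inner ℝ v v) • v := by
      rw [Submodule.reflection_orthogonal_apply, Submodule.reflection_singleton_apply,
        real_inner_self_eq_norm_sq]
      simp only [RCLike.ofReal_real_eq_id, id_eq, two_smul, ← add_smul, neg_sub]
      congr 2
      ring
    rw [h2]
    exact h1
  induction hg using Subgroup.closure_induction with
  | mem g hg => obtain ⟨v, hv, rfl⟩ := hg; exact hr v hv
  | one => exact fun v hv => hv
  | mul a b _ _ ha hb => exact fun v hv => ha _ (hb v hv)
  | inv a _ ha =>
    intro v hv
    have himg : a '' Φ = Φ :=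
      Set.eq_of_subset_of_ncard_le (Set.image_subset_iff.mpr ha)
        (Set.ncard_image_of_injective Φ a.injective).ge h.finite
    obtain ⟨u, hu, rfl⟩ := himg.symm.subset hv
    have : a⁻¹ (a u) = u := a.symm_apply_apply u
    rw [this]
    exact hu

/-- The Weyl group of a root system is finite. -/
theorem weylGroup_finite {n : ℕ} {Φ : Set (RSpace n)} (h : IsRootSystem Φ) :
    (weylGroup Φ : Set (RSpace n ≃ₗᵢ[ℝ] RSpace n)).Finite := by
  have := h.finite.to_subtype
  let F : weylGroup Φ → (Φ → Φ) := fun g v => ⟨g.1 v.1, weylGroup_apply_mem h g.2 v.1 v.2⟩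
  have hF : Function.Injective F := by
    intro a b hab
    apply Subtype.ext
    apply LinearIsometryEquiv.toLinearEquiv_injective
    apply LinearEquiv.toLinearMap_injective
    apply LinearMap.ext_on h.span_eq_top
    intro v hv
    exact congrArg Subtype.val (congrFun hab ⟨v, hv⟩)
  exact Finite.of_injective F hF

/-- Orbits of the Weyl group of a root system are finite, so that sums over them are genuine. -/
theorem weylOrbit_finite {n : ℕ} {Φ : Set (RSpace n)} (h : IsRootSystem Φ) (u : RSpace n) :
    (weylOrbit Φ u).Finite := by
  refine ((weylGroup_finite h).image fun w => w u).subset ?_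
  rintro r ⟨w, hw, rfl⟩
  exact ⟨w, hw, rfl⟩

/-- The generalized cosine: its `k`-th coordinate at `x` is the sum of `exp (2 π i ⟨r, x⟩)` over
the Weyl group orbit of the `k`-th fundamental weight. -/
noncomputable def generalizedCosine {n : ℕ} (Φ : Set (RSpace n)) (ω : Fin n → RSpace n)
    (x : CSpace n) : CSpace n :=
  WithLp.toLp 2 fun k =>
    ∑ᶠ r ∈ weylOrbit Φ (ω k), Complex.exp (2 * Real.pi * Complex.I * inner ℂ (toComplex r) x)

/-- The complex hyperplane `⟨v, x⟩ = l`. -/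
def complexHyperplane {n : ℕ} (v : RSpace n) (l : ℝ) : Set (CSpace n) :=
  {x | inner ℂ (toComplex v) x = (l : ℂ)}

/-- The complex Cartan–Stiefel diagram of the affine Weyl group. -/
def cartanStiefelDiagram {n : ℕ} (Φ : Set (RSpace n)) : Set (CSpace n) :=
  ⋃ v ∈ Φ, ⋃ l : ℤ, complexHyperplane v (l : ℝ)

/-- The image of the Cartan–Stiefel diagram by the generalized cosine. -/
noncomputable def discriminantLocus {n : ℕ} (Φ : Set (RSpace n)) (ω : Fin n → RSpace n) :
    Set (CSpace n) :=
  generalizedCosine Φ ω '' cartanStiefelDiagram Φ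

/-- The functional equation `T ∘ Ψ = Ψ ∘ m_d` that defines the Chebyshev-like map. -/
def IsChebyshevLike {n : ℕ} (Φ : Set (RSpace n)) (ω : Fin n → RSpace n) (d : ℕ)
    (T : CSpace n → CSpace n) : Prop :=
  ∀ x : CSpace n, T (generalizedCosine Φ ω x) = generalizedCosine Φ ω ((d : ℂ) • x)

/-- Polynomial self-maps of complex `n`-space. -/
def IsPolynomialMap {n : ℕ} (f : CSpace n → CSpace n) : Prop :=
  ∃ p : Fin n → MvPolynomial (Fin n) ℂ, ∀ (z : CSpace n) (i : Fin n),
    f z i = MvPolynomial.eval (fun j => z j) (p i)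

/-- The set of points at which the complex derivative is singular. -/
noncomputable def criticalLocus {n : ℕ} (f : CSpace n → CSpace n) : Set (CSpace n) :=
  {c | (fderiv ℂ f c).det = 0}

/-- The union of all strict forward images of the critical locus. -/
noncomputable def postCriticalLocus {n : ℕ} (f : CSpace n → CSpace n) : Set (CSpace n) :=
  ⋃ k : ℕ, ⋃ _ : 1 ≤ k, f^[k] '' criticalLocus f

/-- Closed algebraic subvarieties (not necessarily irreducible) of complex `n`-space. -/
def IsClosedSubvariety {n : ℕ} (Z : Set (CSpace n)) : Prop :=
  ∃ I : Ideal (MvPolynomial (Fin n) ℂ), Z = {z | (fun j => z j) ∈ MvPolynomial.zeroLocus ℂ I}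

/-- A holomorphic self-map is post-critically finite if its critical locus is not everything
and its post-critical locus is a closed, proper subvariety. -/
structure IsPostCriticallyFinite {n : ℕ} (f : CSpace n → CSpace n) : Prop where
  holomorphic : Differentiable ℂ f
  criticalLocus_ne_univ : criticalLocus f ≠ univ
  subvariety : IsClosedSubvariety (postCriticalLocus f)
  proper : postCriticalLocus f ≠ univ

end ChebyshevLike

namespace ChebyshevLike

/-! Write W for the Weyl group, ρ for the sum of the fundamental weights, e^r for the exponential of
frequency r, and Ψ for the generalized cosine. The coordinates of Ψ are W-invariant orbit sums, and
each ω_k is the strictly highest frequency of its own orbit for the height φ. Cancelling highest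
terms shows that these sums freely generate the invariant exponential polynomials with frequencies
in the weight lattice (`exists_aeval_eq`, `eq_zero_of_aeval_eq_zero`). Their Jacobian is
anti-invariant with leading term e^ρ, and so is the Weyl denominator e^ρ ∏ (1 - e^(-v)) over the
positive roots v. An anti-invariant of height at most φ(ρ) is determined by its coefficient at ρ, so
the two coincide (`orbitJacobian_eq`), and the zeros of the product are the hyperplanes of the
diagram.

Averaging over W and the Nullstellensatz make Ψ surjective (`surjective_generalizedCosine`), so a
Chebyshev-like map T is unique; it exists and is polynomial because the coordinates of Ψ(d x) are
again invariant. By the chain rule the Jacobian of T at Ψ(x) is, up to the factor d^n, the quotient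
of the Weyl denominators at d x and at x. It vanishes exactly when d⟨v, x⟩ is an integer not
divisible by d for some positive root v (`mem_criticalLocus_iff`). Multiplication by d keeps such
points d x in the diagram; conversely, coroot translations, which Ψ does not see, and division by a
power of d trace every point of the diagram back to a critical point (`postCriticalLocus_eq`).

The square of the Weyl denominator is invariant, hence a polynomial in Ψ, and it cuts out the
discriminant locus. Independence of the choice of weights holds because W acts transitively on
positive systems (`exists_map_positiveRoots`). -/

variable {n : ℕ} {Φ : Set (RSpace n)} {φ : RSpace n →ₗ[ℝ] ℝ} {α ω : Fin n → RSpace n}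

/-! ### Reflections and coroots. -/

/-- The orthogonal reflection across the hyperplane perpendicular to `v`. -/
noncomputable def rootReflection (v : RSpace n) : RSpace n ≃ₗᵢ[ℝ] RSpace n :=
  (Submodule.span ℝ {v})ᗮ.reflection

theorem rootReflection_apply (v w : RSpace n) :
    rootReflection v w = w - inner ℝ w (coroot v) • v := by
  rw [rootReflection, Submodule.reflection_orthogonal_apply,
    Submodule.reflection_singleton_apply, coroot, real_inner_smul_right, real_inner_comm v w,
    real_inner_self_eq_norm_sq]
  simp only [RCLike.ofReal_real_eq_id, id_eq, two_smul, ← add_smul, neg_sub]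
  congr 2
  ring

theorem rootReflection_rootReflection (v w : RSpace n) :
    rootReflection v (rootReflection v w) = w :=
  Submodule.reflection_reflection _ _

theorem rootReflection_inv (v : RSpace n) : (rootReflection v)⁻¹ = rootReflection v :=
  Submodule.reflection_inv

theorem coroot_map (g : RSpace n ≃ₗᵢ[ℝ] RSpace n) (v : RSpace n) :
    coroot (g v) = g (coroot v) := by
  simp [coroot]

theorem coroot_neg (v : RSpace n) : coroot (-v) = -coroot v := by
  simp [coroot]

theorem inner_coroot_self {v : RSpace n} (hv : v ≠ 0) : inner ℝ v (coroot v) = 2 := by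
  rw [coroot, real_inner_smul_right]
  exact div_mul_cancel₀ _ (inner_self_ne_zero.2 hv)

theorem rootReflection_self (v : RSpace n) : rootReflection v v = -v := by
  by_cases hv : v = 0
  · simp [hv]
  · rw [rootReflection_apply, inner_coroot_self hv, two_smul]
    abel

theorem rootReflection_neg (v : RSpace n) : rootReflection (-v) = rootReflection v := by
  ext1 w
  simp [rootReflection_apply, coroot_neg]

theorem rootReflection_map (g : RSpace n ≃ₗᵢ[ℝ] RSpace n) (v : RSpace n) :
    rootReflection (g v) = g * rootReflection v * g⁻¹ := by
  ext1 w
  have h : inner ℝ w (g (coroot v)) = inner ℝ (g⁻¹ w) (coroot v) := by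
    conv_lhs => rw [show w = g (g⁻¹ w) from (g.apply_symm_apply w).symm]
    exact g.inner_map_map _ _
  have hw : g (g⁻¹ w) = w := g.apply_symm_apply w
  rw [rootReflection_apply, coroot_map, h]
  simp only [LinearIsometryEquiv.coe_mul, Function.comp_apply, rootReflection_apply, map_sub,
    map_smul, hw]

theorem inner_coroot_eq (v w : RSpace n) :
    inner ℝ w (coroot v) = 2 * inner ℝ v w / inner ℝ v v := by
  rw [coroot, real_inner_smul_right, real_inner_comm v w]
  ring

theorem inner_inv_apply (g : RSpace n ≃ₗᵢ[ℝ] RSpace n) (v w : RSpace n) :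
    inner ℝ (g⁻¹ v) w = inner ℝ v (g w) := by
  conv_rhs => rw [show v = g (g⁻¹ v) from (g.apply_symm_apply v).symm]
  exact (g.inner_map_map _ _).symm

theorem rootReflection_mem_weylGroup {v : RSpace n} (hv : v ∈ Φ) :
    rootReflection v ∈ weylGroup Φ :=
  Subgroup.subset_closure ⟨v, hv, rfl⟩

/-! ### Simple roots form a basis; existence of fundamental weights. -/

namespace IsRootSystem

theorem ne_zero (h : IsRootSystem Φ) {v : RSpace n} (hv : v ∈ Φ) : v ≠ 0 := by
  rintro rfl
  have := (h.smul_mem_iff 0 hv 0).1 (by simpa using hv)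
  norm_num at this

theorem neg_mem (h : IsRootSystem Φ) {v : RSpace n} (hv : v ∈ Φ) : -v ∈ Φ := by
  simpa using (h.smul_mem_iff v hv (-1)).2 (Or.inr rfl)

theorem exists_int_inner_coroot (h : IsRootSystem Φ) {v w : RSpace n} (hv : v ∈ Φ) (hw : w ∈ Φ) :
    ∃ m : ℤ, inner ℝ w (coroot v) = m := by
  rw [inner_coroot_eq]
  exact h.integral v hv w hw

/-- By Cauchy–Schwarz the two Cartan integers are positive with product at most 4. If one of them is
1, a reflection yields `v - w` up to sign; the only other case is that both are 2, and then `v - w`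
has norm zero. -/
theorem sub_mem_of_inner_pos (h : IsRootSystem Φ) {v w : RSpace n} (hv : v ∈ Φ) (hw : w ∈ Φ)
    (hne : v ≠ w) (hpos : 0 < inner ℝ v w) : v - w ∈ Φ := by
  have hv0 : 0 < inner ℝ v v := real_inner_self_pos.2 (h.ne_zero hv)
  have hw0 : 0 < inner ℝ w w := real_inner_self_pos.2 (h.ne_zero hw)
  obtain ⟨a, ha⟩ := h.integral v hv w hw
  obtain ⟨b, hb⟩ := h.integral w hw v hv
  rw [real_inner_comm] at hb
  have hrv := h.reflection_mem v hv w hw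
  have hrw := h.reflection_mem w hw v hv
  rw [real_inner_comm v w] at hrw
  rw [ha] at hrv
  rw [hb] at hrw
  have ha' : 2 * inner ℝ v w = a * inner ℝ v v := by rw [← ha]; field_simp
  have hb' : 2 * inner ℝ v w = b * inner ℝ w w := by rw [← hb]; field_simp
  have ha0 : 0 < a := by
    have : (0 : ℝ) < a := by rw [← ha]; positivity
    exact_mod_cast this
  have hb0 : 0 < b := by
    have : (0 : ℝ) < b := by rw [← hb]; positivity
    exact_mod_cast this
  have hcs := real_inner_mul_inner_self_le v w
  have hab : a * b ≤ 4 := by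
    have h4 : (a : ℝ) * b * (inner ℝ v v * inner ℝ w w) ≤ 4 * (inner ℝ v v * inner ℝ w w) := by
      calc (a : ℝ) * b * (inner ℝ v v * inner ℝ w w)
          = 4 * (inner ℝ v w * inner ℝ v w) := by
            linear_combination -(2 * inner ℝ v w) * hb' - b * inner ℝ w w * ha'
        _ ≤ _ := by linarith
    exact_mod_cast le_of_mul_le_mul_right h4 (by positivity)
  have hcase : a = 1 ∨ b = 1 ∨ (a = 2 ∧ b = 2) := by
    by_contra! hcon
    have ha2 : 2 ≤ a := by omega
    have hb2 : 2 ≤ b := by omega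
    have : a = 2 := by nlinarith
    have : b = 2 := by nlinarith
    exact hcon.2.2 ‹_› ‹_›
  rcases hcase with rfl | rfl | ⟨rfl, rfl⟩
  · have := h.neg_mem hrv
    simpa using this
  · simpa using hrw
  · refine absurd (sub_eq_zero.1 ?_) hne
    rw [← inner_self_eq_zero (𝕜 := ℝ), real_inner_sub_sub_self]
    push_cast at ha' hb'
    linarith

theorem reflection_image_mem (h : IsRootSystem Φ) {v w : RSpace n} (hv : v ∈ Φ) (hw : w ∈ Φ) :
    rootReflection v w ∈ Φ :=
  weylGroup_apply_mem h (rootReflection_mem_weylGroup hv) w hw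

theorem mem_positiveRoots_or (h : IsRootSystem Φ) (hφ : ∀ v ∈ Φ, φ v ≠ 0) {v : RSpace n}
    (hv : v ∈ Φ) : v ∈ positiveRoots Φ φ ∨ -v ∈ positiveRoots Φ φ := by
  rcases (hφ v hv).lt_or_gt with h1 | h1
  · exact Or.inr ⟨h.neg_mem hv, by simpa using h1⟩
  · exact Or.inl ⟨hv, h1⟩

theorem finite_positiveRoots (h : IsRootSystem Φ) : (positiveRoots Φ φ).Finite :=
  h.finite.subset fun _ hv => hv.1

/-- A counterexample of least height is not simple, so it splits into two positive roots of smaller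
height, which already lie in the closure. -/
theorem mem_closure_simpleRoots (h : IsRootSystem Φ) {v : RSpace n}
    (hv : v ∈ positiveRoots Φ φ) : v ∈ AddSubmonoid.closure (simpleRoots Φ φ) := by
  by_contra hcon
  let s : Set (RSpace n) := {v | v ∈ positiveRoots Φ φ ∧ v ∉ AddSubmonoid.closure (simpleRoots Φ φ)}
  obtain ⟨a, ⟨ha, ha'⟩, hmin⟩ := Set.exists_min_image s φ
    (h.finite_positiveRoots.subset fun _ hv => hv.1) ⟨v, hv, hcon⟩
  have hns : a ∉ simpleRoots Φ φ := fun hs => ha' (AddSubmonoid.subset_closure hs)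
  have : ∃ v ∈ positiveRoots Φ φ, ∃ w ∈ positiveRoots Φ φ, v ≠ w ∧ a = v + w := by
    by_contra hx
    exact hns ⟨ha, hx⟩
  obtain ⟨x, hx, y, hy, -, rfl⟩ := this
  have key : ∀ z ∈ positiveRoots Φ φ, φ z < φ (x + y) →
      z ∈ AddSubmonoid.closure (simpleRoots Φ φ) := by
    intro z hz hlt
    by_contra hzn
    exact absurd (hmin z ⟨hz, hzn⟩) (not_le.2 hlt)
  have hx2 := hx.2
  have hy2 := hy.2
  exact ha' (add_mem (key x hx (by rw [map_add]; linarith)) (key y hy (by rw [map_add]; linarith)))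

/-- Otherwise `a - b` is a root, and whichever of `a - b` and `b - a` is positive splits `a` or `b`
into a sum of positive roots. -/
theorem inner_simpleRoots_nonpos (h : IsRootSystem Φ) (hφ : ∀ v ∈ Φ, φ v ≠ 0) {a b : RSpace n}
    (ha : a ∈ simpleRoots Φ φ) (hb : b ∈ simpleRoots Φ φ) (hab : a ≠ b) : inner ℝ a b ≤ 0 := by
  by_contra! hpos
  have key : ∀ {a b : RSpace n}, a ∈ simpleRoots Φ φ → b ∈ simpleRoots Φ φ →
      ¬ a - b ∈ positiveRoots Φ φ := by
    intro a b ha hb hs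
    refine ha.2 ⟨a - b, hs, b, hb.1, ?_, by abel⟩
    -- Simplicity only forbids sums of distinct roots; the remaining case `a = 2b` is excluded
    -- because the root system is reduced.
    intro heq
    have h2 : (2 : ℝ) • b ∈ Φ := by
      have : a = (2 : ℝ) • b := by rw [two_smul, ← sub_eq_iff_eq_add]; exact heq
      exact this ▸ ha.1.1
    have := (h.smul_mem_iff b hb.1.1 2).1 h2
    norm_num at this
  rcases h.mem_positiveRoots_or hφ (h.sub_mem_of_inner_pos ha.1.1 hb.1.1 hab hpos) with h1 | h1
  · exact key ha hb h1
  · exact key hb ha (by simpa using h1)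

/-- Vectors on one side of a hyperplane with pairwise nonpositive inner products are linearly
independent. -/
theorem linearIndependent_simpleRoots (h : IsRootSystem Φ) (hφ : ∀ v ∈ Φ, φ v ≠ 0) :
    LinearIndependent ℝ (fun a : simpleRoots Φ φ => (a : RSpace n)) := by
  refine LinearMap.BilinForm.linearIndependent_of_pairwise_le_zero (innerₗ (RSpace n)) ?_ φ _
    (fun a => a.2.1.2) ?_
  · intro x hx
    simpa using real_inner_self_pos.2 hx
  · intro a b hab
    exact h.inner_simpleRoots_nonpos hφ a.2 b.2 (fun e => hab (Subtype.ext e))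

theorem span_simpleRoots (h : IsRootSystem Φ) (hφ : ∀ v ∈ Φ, φ v ≠ 0) :
    Submodule.span ℝ (simpleRoots Φ φ) = ⊤ := by
  rw [eq_top_iff, ← h.span_eq_top, Submodule.span_le]
  have key : ∀ v ∈ positiveRoots Φ φ, v ∈ Submodule.span ℝ (simpleRoots Φ φ) := by
    intro v hv
    have hle : AddSubmonoid.closure (simpleRoots Φ φ) ≤
        (Submodule.span ℝ (simpleRoots Φ φ)).toAddSubmonoid :=
      AddSubmonoid.closure_le.2 Submodule.subset_span
    exact hle (h.mem_closure_simpleRoots hv)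
  intro v hv
  rcases h.mem_positiveRoots_or hφ hv with h1 | h1
  · exact key v h1
  · simpa using Submodule.neg_mem _ (key _ h1)

theorem exists_isFundamentalWeights (h : IsRootSystem Φ) :
    ∃ ω : Fin n → RSpace n, IsFundamentalWeights Φ ω := by
  have hfin := h.finite.to_subtype
  obtain ⟨φ, hφ⟩ := Module.exists_dual_forall_apply_ne_zero (K := ℝ) (fun v : Φ => (v : RSpace n))
    (fun v => h.ne_zero v.2)
  have hφ' : ∀ v ∈ Φ, φ v ≠ 0 := fun v hv => hφ ⟨v, hv⟩
  let b : Module.Basis (simpleRoots Φ φ) ℝ (RSpace n) :=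
    Module.Basis.mk (h.linearIndependent_simpleRoots hφ') (by
      rw [Subtype.range_coe, h.span_simpleRoots hφ'])
  have : Fintype (simpleRoots Φ φ) := (h.finite_positiveRoots.subset fun _ hv => hv.1).fintype
  have hcard : Fintype.card (simpleRoots Φ φ) = Fintype.card (Fin n) := by
    rw [← Module.finrank_eq_card_basis b]
    simp
  let e : simpleRoots Φ φ ≃ Fin n := Fintype.equivOfCardEq hcard
  let b' := b.reindex e
  have hb' : ∀ k, b' k = (e.symm k : RSpace n) := fun k => by simp [b', b]
  have hpos : ∀ k, 0 < inner ℝ (b' k) (b' k) := fun k => real_inner_self_pos.2 (b'.ne_zero k)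
  -- The weight is the Riesz representative of a coordinate functional; the factor ⟨α, α⟩/2 cancels
  -- the normalization of the coroot.
  refine ⟨fun j => (InnerProductSpace.toDual ℝ (RSpace n)).symm
      (LinearMap.toContinuousLinearMap ((inner ℝ (b' j) (b' j) / 2) • b'.coord j)),
    φ, hφ', b', b'.injective, ?_, ?_⟩
  · ext v
    constructor
    · rintro ⟨k, rfl⟩
      rw [hb']
      exact (e.symm k).2
    · intro hv
      exact ⟨e ⟨v, hv⟩, by simp [hb']⟩
  · intro j k
    rw [InnerProductSpace.toDual_symm_apply]
    have := (hpos j).ne'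
    by_cases hjk : j = k
    · subst hjk
      rw [if_pos rfl, coroot, map_smul, LinearMap.coe_toContinuousLinearMap', LinearMap.smul_apply,
        Module.Basis.coord_apply, Module.Basis.repr_self, Finsupp.single_eq_same, smul_eq_mul,
        smul_eq_mul]
      field_simp
    · simp [coroot, hjk]

end IsRootSystem

/-! ### The Weyl group: simple reflections, exchange, dominant vectors, positive systems. -/

/-- A root system with a regular functional `φ`, an enumeration `α` of the simple roots of `φ`,
and the family `ω` dual to the simple coroots. -/
structure IsWeightSystem (Φ : Set (RSpace n)) (φ : RSpace n →ₗ[ℝ] ℝ) (α ω : Fin n → RSpace n) :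
    Prop where
  isRootSystem : IsRootSystem Φ
  ne_zero : ∀ v ∈ Φ, φ v ≠ 0
  injective : Function.Injective α
  range_eq : range α = simpleRoots Φ φ
  dual : ∀ j k : Fin n, inner ℝ (ω j) (coroot (α k)) = if j = k then (1 : ℝ) else 0

/-- A vector is dominant if its inner products with the simple coroots are nonnegative. -/
def IsDominant (α : Fin n → RSpace n) (x : RSpace n) : Prop :=
  ∀ i, 0 ≤ inner ℝ x (coroot (α i))

/-- The product of the reflections in a list of simple roots. -/
noncomputable def reflectionWord (α : Fin n → RSpace n) (l : List (Fin n)) :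
    RSpace n ≃ₗᵢ[ℝ] RSpace n :=
  (l.map fun i => rootReflection (α i)).prod

theorem inner_coroot_nonneg_iff {v w : RSpace n} (hv : v ≠ 0) :
    0 ≤ inner ℝ w (coroot v) ↔ 0 ≤ inner ℝ w v := by
  have : 0 < 2 / inner ℝ v v := div_pos two_pos (real_inner_self_pos.2 hv)
  rw [coroot, real_inner_smul_right, mul_nonneg_iff_of_pos_left this]

theorem inner_coroot_pos_iff {v w : RSpace n} (hv : v ≠ 0) :
    0 < inner ℝ w (coroot v) ↔ 0 < inner ℝ w v := by
  have : 0 < 2 / inner ℝ v v := div_pos two_pos (real_inner_self_pos.2 hv)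
  rw [coroot, real_inner_smul_right, mul_pos_iff_of_pos_left this]

theorem inner_coroot_eq_zero_iff {v w : RSpace n} (hv : v ≠ 0) :
    inner ℝ w (coroot v) = 0 ↔ inner ℝ w v = 0 := by
  have : 0 < 2 / inner ℝ v v := div_pos two_pos (real_inner_self_pos.2 hv)
  rw [coroot, real_inner_smul_right, mul_eq_zero_iff_left this.ne']

theorem mul_rootReflection_mul_inv_mul (g : RSpace n ≃ₗᵢ[ℝ] RSpace n) (v : RSpace n) :
    g * rootReflection v * g⁻¹ * g * rootReflection v = g := by
  ext1 x
  have hg : g⁻¹ (g (rootReflection v x)) = rootReflection v x := g.symm_apply_apply _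
  simp only [LinearIsometryEquiv.coe_mul, Function.comp_apply, hg, rootReflection_rootReflection]

theorem weylOrbit_map {g : RSpace n ≃ₗᵢ[ℝ] RSpace n} (hg : g ∈ weylGroup Φ) (x : RSpace n) :
    weylOrbit Φ (g x) = weylOrbit Φ x := by
  ext r
  constructor
  · rintro ⟨k, hk, rfl⟩
    exact ⟨k * g, Subgroup.mul_mem _ hk hg, rfl⟩
  · rintro ⟨k, hk, rfl⟩
    refine ⟨k * g⁻¹, Subgroup.mul_mem _ hk (Subgroup.inv_mem _ hg), ?_⟩
    exact congrArg k (g.symm_apply_apply x).symm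

theorem map_mem_weylOrbit {g : RSpace n ≃ₗᵢ[ℝ] RSpace n} (hg : g ∈ weylGroup Φ) {x r : RSpace n}
    (hr : r ∈ weylOrbit Φ x) : g r ∈ weylOrbit Φ x := by
  obtain ⟨k, hk, rfl⟩ := hr
  exact ⟨g * k, Subgroup.mul_mem _ hg hk, rfl⟩

namespace IsWeightSystem

variable (h : IsWeightSystem Φ φ α ω)
include h

theorem simple_mem (i : Fin n) : α i ∈ simpleRoots Φ φ := h.range_eq ▸ mem_range_self i

theorem simple_mem_positiveRoots (i : Fin n) : α i ∈ positiveRoots Φ φ := (h.simple_mem i).1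

theorem simple_mem_root (i : Fin n) : α i ∈ Φ := (h.simple_mem i).1.1

theorem simple_pos (i : Fin n) : 0 < φ (α i) := (h.simple_mem i).1.2

theorem simple_ne_zero (i : Fin n) : α i ≠ 0 := h.isRootSystem.ne_zero (h.simple_mem_root i)

theorem linearIndependent_coroot : LinearIndependent ℝ fun k => coroot (α k) := by
  rw [Fintype.linearIndependent_iff]
  intro g hg j
  have := congrArg (fun x => inner ℝ (ω j) x) hg
  simpa [inner_sum, real_inner_smul_right, h.dual] using this

/-- The basis of simple coroots. -/
noncomputable def corootBasis : Module.Basis (Fin n) ℝ (RSpace n) :=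
  Module.Basis.mk h.linearIndependent_coroot
    (h.linearIndependent_coroot.span_eq_top_of_card_eq_finrank' (by simp)).ge

theorem corootBasis_apply (k : Fin n) : h.corootBasis k = coroot (α k) := by
  simp [corootBasis]

theorem sum_inner_smul_coroot (x : RSpace n) : ∑ k, inner ℝ (ω k) x • coroot (α k) = x := by
  have hx := h.corootBasis.sum_repr x
  have hr : ∀ j, h.corootBasis.repr x j = inner ℝ (ω j) x := by
    intro j
    conv_rhs => rw [← hx]
    simp [inner_sum, real_inner_smul_right, h.dual, h.corootBasis_apply]
  simpa [hr, h.corootBasis_apply] using hx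

theorem ext_coroot {x y : RSpace n}
    (hxy : ∀ k, inner ℝ x (coroot (α k)) = inner ℝ y (coroot (α k))) : x = y := by
  refine InnerProductSpace.ext_inner_right_basis h.corootBasis fun k => ?_
  rw [h.corootBasis_apply]
  exact hxy k

theorem sum_inner_coroot_smul (x : RSpace n) : ∑ k, inner ℝ x (coroot (α k)) • ω k = x := by
  refine h.ext_coroot fun j => ?_
  simp [sum_inner, real_inner_smul_left, h.dual]

theorem positive_induction {p : RSpace n → Prop} (h0 : p 0) (hα : ∀ i, p (α i))
    (hadd : ∀ x y, p x → p y → p (x + y)) {v : RSpace n} (hv : v ∈ positiveRoots Φ φ) : p v := by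
  have := h.isRootSystem.mem_closure_simpleRoots hv
  rw [← h.range_eq] at this
  clear hv
  induction this using AddSubmonoid.closure_induction with
  | mem x hx => obtain ⟨i, rfl⟩ := hx; exact hα i
  | zero => exact h0
  | add x y _ _ hx hy => exact hadd x y hx hy

theorem inner_nonneg_of_isDominant {x v : RSpace n} (hx : IsDominant α x)
    (hv : v ∈ positiveRoots Φ φ) : 0 ≤ inner ℝ x v := by
  refine h.positive_induction (p := fun v => 0 ≤ inner ℝ x v) (by simp) (fun i => ?_)
    (fun y z hy hz => by rw [inner_add_right]; exact add_nonneg hy hz) hv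
  exact (inner_coroot_nonneg_iff (h.simple_ne_zero i)).1 (hx i)

theorem isDominant_weight (k : Fin n) : IsDominant α (ω k) := by
  intro i
  rw [h.dual]
  split_ifs <;> norm_num

/-- For j ≠ i, `ω j` is orthogonal to `α i`, so it pairs equally with `v` and its reflection. If the
reflection were negative, all these pairings would vanish, leaving `v` proportional to `α i`, hence
equal to ±`α i`. -/
theorem reflection_simple_positive {i : Fin n} {v : RSpace n} (hv : v ∈ positiveRoots Φ φ)
    (hvi : v ≠ α i) : rootReflection (α i) v ∈ positiveRoots Φ φ := by
  have hm := h.isRootSystem.reflection_image_mem (h.simple_mem_root i) hv.1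
  refine (h.isRootSystem.mem_positiveRoots_or h.ne_zero hm).resolve_right fun hneg => ?_
  have hz : ∀ j, j ≠ i → inner ℝ (ω j) v = 0 := by
    intro j hj
    have h1 := h.inner_nonneg_of_isDominant (h.isDominant_weight j) hv
    have h2 := h.inner_nonneg_of_isDominant (h.isDominant_weight j) hneg
    have h3 : inner ℝ (ω j) (α i) = 0 := by
      rw [← inner_coroot_eq_zero_iff (h.simple_ne_zero i), h.dual, if_neg hj]
    rw [rootReflection_apply, inner_neg_right, inner_sub_right, real_inner_smul_right, h3] at h2
    linarith
  have hs : v = (inner ℝ (ω i) v * (2 / inner ℝ (α i) (α i))) • α i := by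
    conv_lhs => rw [← h.sum_inner_smul_coroot v]
    rw [Finset.sum_eq_single i (fun j _ hj => by rw [hz j hj, zero_smul]) (by simp), coroot,
      smul_smul]
  rcases (h.isRootSystem.smul_mem_iff _ (h.simple_mem_root i) _).1 (hs ▸ hv.1) with h1 | h1
  · rw [h1, one_smul] at hs
    exact hvi hs
  · rw [h1, neg_one_smul] at hs
    have := hv.2
    rw [hs, map_neg] at this
    linarith [h.simple_pos i]

/-- Otherwise ⟨v, v⟩ ≤ 0, since `v` is a nonnegative combination of simple roots. -/
theorem exists_inner_simple_pos {v : RSpace n} (hv : v ∈ positiveRoots Φ φ) :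
    ∃ i, 0 < inner ℝ v (α i) := by
  by_contra! hcon
  have : inner ℝ v v ≤ 0 :=
    h.positive_induction (p := fun w => inner ℝ v w ≤ 0) (by simp) hcon
      (fun y z hy hz => by rw [inner_add_right]; exact add_nonpos hy hz) hv
  exact absurd (real_inner_self_pos.2 (h.isRootSystem.ne_zero hv.1)) (not_lt.2 this)

/-- Among the positive roots conjugate to `v` under simple reflections, take one of least height. A
simple root having positive inner product with it must equal it, since otherwise reflecting would
give a lower positive root. -/
theorem exists_map_simple_of_mem_positiveRoots {v : RSpace n} (hv : v ∈ positiveRoots Φ φ) :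
    ∃ g ∈ Subgroup.closure (range fun i => rootReflection (α i)), ∃ i, v = g (α i) := by
  let G := Subgroup.closure (range fun i => rootReflection (α i))
  have hs : ∀ i, rootReflection (α i) ∈ G := fun i => Subgroup.subset_closure ⟨i, rfl⟩
  obtain ⟨a, ⟨ha, g, hg, rfl⟩, hmin⟩ := Set.exists_min_image
    {a | a ∈ positiveRoots Φ φ ∧ ∃ g ∈ G, a = g v} φ
    (h.isRootSystem.finite_positiveRoots.subset fun _ hv => hv.1) ⟨v, hv, 1, G.one_mem, rfl⟩
  obtain ⟨i, hi⟩ := h.exists_inner_simple_pos ha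
  refine ⟨g⁻¹, G.inv_mem hg, i, ?_⟩
  by_contra hne
  have hgv : g v ≠ α i := fun hx => hne (by rw [← hx]; exact (g.symm_apply_apply v).symm)
  have := hmin _ ⟨h.reflection_simple_positive ha hgv, rootReflection (α i) * g,
    G.mul_mem (hs i) hg, rfl⟩
  rw [rootReflection_apply, map_sub, map_smul, smul_eq_mul] at this
  have := mul_pos ((inner_coroot_pos_iff (h.simple_ne_zero i)).2 hi) (h.simple_pos i)
  linarith

/-- A root g α_i has reflection g s_i g⁻¹, and every positive root is of this form with g a product
of simple reflections. -/
theorem closure_simple_reflections :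
    Subgroup.closure (range fun i => rootReflection (α i)) = weylGroup Φ := by
  refine le_antisymm ((Subgroup.closure_le _).2 ?_) ((Subgroup.closure_le _).2 ?_)
  · rintro _ ⟨i, rfl⟩
    exact rootReflection_mem_weylGroup (h.simple_mem_root i)
  · have key : ∀ v ∈ positiveRoots Φ φ,
        rootReflection v ∈ Subgroup.closure (range fun i => rootReflection (α i)) := by
      intro v hv
      obtain ⟨g, hg, i, rfl⟩ := h.exists_map_simple_of_mem_positiveRoots hv
      rw [rootReflection_map]
      exact Subgroup.mul_mem _ (Subgroup.mul_mem _ hg (Subgroup.subset_closure ⟨i, rfl⟩))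
        (Subgroup.inv_mem _ hg)
    rintro _ ⟨v, hv, rfl⟩
    rcases h.isRootSystem.mem_positiveRoots_or h.ne_zero hv with h1 | h1
    · exact key v h1
    · have := key _ h1
      rwa [rootReflection_neg] at this

theorem exists_map_simple {v : RSpace n} (hv : v ∈ Φ) : ∃ g ∈ weylGroup Φ, ∃ i, v = g (α i) := by
  rw [← h.closure_simple_reflections]
  rcases h.isRootSystem.mem_positiveRoots_or h.ne_zero hv with h1 | h1
  · exact h.exists_map_simple_of_mem_positiveRoots h1
  · obtain ⟨g, hg, i, hgi⟩ := h.exists_map_simple_of_mem_positiveRoots h1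
    refine ⟨g * rootReflection (α i), Subgroup.mul_mem _ hg (Subgroup.subset_closure ⟨i, rfl⟩),
      i, ?_⟩
    rw [LinearIsometryEquiv.coe_mul, Function.comp_apply, rootReflection_self, map_neg, ← hgi,
      neg_neg]

theorem exists_reflectionWord {g : RSpace n ≃ₗᵢ[ℝ] RSpace n} (hg : g ∈ weylGroup Φ) :
    ∃ l, g = reflectionWord α l := by
  rw [← h.closure_simple_reflections] at hg
  induction hg using Subgroup.closure_induction_left with
  | one => exact ⟨[], rfl⟩
  | mul_left x hx y _ hy =>
    obtain ⟨i, rfl⟩ := hx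
    obtain ⟨l, rfl⟩ := hy
    exact ⟨i :: l, by simp [reflectionWord]⟩
  | inv_mul_cancel x hx y _ hy =>
    obtain ⟨i, rfl⟩ := hx
    obtain ⟨l, rfl⟩ := hy
    exact ⟨i :: l, by simp [reflectionWord, rootReflection_inv]⟩

theorem map_mem {g : RSpace n ≃ₗᵢ[ℝ] RSpace n} (hg : g ∈ weylGroup Φ) {v : RSpace n}
    (hv : v ∈ Φ) : g v ∈ Φ :=
  weylGroup_apply_mem h.isRootSystem hg v hv

/-- The exchange property. -/
theorem exists_exchange (l : List (Fin n)) (i : Fin n)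
    (hl : reflectionWord α l (α i) ∉ positiveRoots Φ φ) :
    ∃ l' : List (Fin n), l'.length + 1 = l.length ∧
      reflectionWord α l * rootReflection (α i) = reflectionWord α l' := by
  induction l with
  | nil => exact absurd (h.simple_mem_positiveRoots i) hl
  | cons j l ih =>
    have hcons : ∀ l, reflectionWord α (j :: l) = rootReflection (α j) * reflectionWord α l :=
      fun l => by simp [reflectionWord]
    -- If the shorter word keeps `α i` positive while the letter `j` makes it negative, then it
    -- sends `α i` to `α j`. It therefore conjugates one reflection into the other, and the letter
    -- `j` cancels. Otherwise the deletion happens further inside the word.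
    by_cases hp : reflectionWord α l (α i) ∈ positiveRoots Φ φ
    · refine ⟨l, rfl, ?_⟩
      have heq : reflectionWord α l (α i) = α j := by
        by_contra hne
        refine hl ?_
        rw [hcons, LinearIsometryEquiv.coe_mul, Function.comp_apply]
        exact h.reflection_simple_positive hp hne
      have hr := rootReflection_map (reflectionWord α l) (α i)
      rw [heq] at hr
      rw [hcons, hr]
      exact mul_rootReflection_mul_inv_mul _ _
    · obtain ⟨l', hlen, hl'⟩ := ih hp
      exact ⟨j :: l', by simp [hlen], by rw [hcons, hcons, mul_assoc, hl']⟩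

/-- Induction on the length of a word for `g`. A last letter fixing `x` can be dropped. Otherwise x
pairs strictly positively with `α i`, and dominance of `g x` forces the preceding word to send `α i`
to a negative root, so exchange shortens the word. -/
theorem map_eq_self_of_isDominant {x : RSpace n} (hx : IsDominant α x)
    {g : RSpace n ≃ₗᵢ[ℝ] RSpace n} (hg : g ∈ weylGroup Φ) (hgx : IsDominant α (g x)) :
    g x = x := by
  have key : ∀ N : ℕ, ∀ l : List (Fin n), l.length = N → IsDominant α (reflectionWord α l x) →
      reflectionWord α l x = x := by
    intro N
    induction N using Nat.strong_induction_on with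
    | _ N ih =>
      intro l hlN hdom
      rcases List.eq_nil_or_concat l with rfl | ⟨m, i, rfl⟩
      · simp [reflectionWord]
      · have hw : reflectionWord α (m ++ [i]) = reflectionWord α m * rootReflection (α i) := by
          simp [reflectionWord]
        rw [List.concat_eq_append] at hlN hdom ⊢
        rw [List.length_append, List.length_singleton] at hlN
        rw [hw] at hdom ⊢
        rcases (hx i).eq_or_lt with h0 | hpos
        · have hfix : rootReflection (α i) x = x := by
            rw [rootReflection_apply, ← h0, zero_smul, sub_zero]
          have hmx : (reflectionWord α m * rootReflection (α i)) x = reflectionWord α m x := by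
            rw [LinearIsometryEquiv.coe_mul, Function.comp_apply, hfix]
          rw [hmx] at hdom ⊢
          exact ih m.length (by omega) m rfl hdom
        · have hnot : reflectionWord α m (α i) ∉ positiveRoots Φ φ := by
            intro hp
            have h1 := h.inner_nonneg_of_isDominant hdom hp
            have h2 : reflectionWord α m (α i) =
                (reflectionWord α m * rootReflection (α i)) (-α i) := by
              rw [LinearIsometryEquiv.coe_mul, Function.comp_apply, map_neg, rootReflection_self,
                neg_neg]
            rw [h2, LinearIsometryEquiv.inner_map_map, inner_neg_right] at h1
            have := (inner_coroot_pos_iff (h.simple_ne_zero i)).1 hpos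
            linarith
          obtain ⟨l', hlen, hl'⟩ := h.exists_exchange m i hnot
          rw [hl'] at hdom ⊢
          exact ih l'.length (by omega) l' rfl hdom
  obtain ⟨l, rfl⟩ := h.exists_reflectionWord hg
  exact key _ l rfl hgx

theorem isDominant_of_forall_le {x : RSpace n}
    (hx : ∀ i, φ (rootReflection (α i) x) ≤ φ x) : IsDominant α x := by
  intro i
  have := hx i
  rw [rootReflection_apply, map_sub, map_smul, smul_eq_mul] at this
  exact nonneg_of_mul_nonneg_left (by linarith) (h.simple_pos i)

/-- A highest element of the orbit is dominant, hence equal to `x`; the maximum of the height is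
attained there only. -/
theorem map_lt_of_isDominant {x : RSpace n} (hx : IsDominant α x)
    {g : RSpace n ≃ₗᵢ[ℝ] RSpace n} (hg : g ∈ weylGroup Φ) (hgx : g x ≠ x) : φ (g x) < φ x := by
  have hmax : ∀ y ∈ weylOrbit Φ x, (∀ z ∈ weylOrbit Φ x, φ z ≤ φ y) → y = x := by
    rintro _ ⟨k, hk, rfl⟩ hmax
    refine h.map_eq_self_of_isDominant hx hk (h.isDominant_of_forall_le fun i => ?_)
    exact hmax _ ⟨rootReflection (α i) * k,
      Subgroup.mul_mem _ (rootReflection_mem_weylGroup (h.simple_mem_root i)) hk, rfl⟩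
  have hgo : g x ∈ weylOrbit Φ x := ⟨g, hg, rfl⟩
  obtain ⟨y, hy, hym⟩ := Set.exists_max_image (weylOrbit Φ x) φ
    (weylOrbit_finite h.isRootSystem x) ⟨_, hgo⟩
  have hyx := hmax y hy hym
  subst hyx
  refine lt_of_le_of_ne (hym _ hgo) fun heq => hgx (hmax _ hgo fun z hz => ?_)
  rw [heq]
  exact hym z hz

theorem map_le_of_isDominant {x : RSpace n} (hx : IsDominant α x)
    {g : RSpace n ≃ₗᵢ[ℝ] RSpace n} (hg : g ∈ weylGroup Φ) : φ (g x) ≤ φ x := by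
  by_cases hgx : g x = x
  · rw [hgx]
  · exact (h.map_lt_of_isDominant hx hg hgx).le

theorem eq_zero_of_forall_reflection {x : RSpace n}
    (hx : ∀ i, rootReflection (α i) x = x) : x = 0 := by
  refine h.ext_coroot fun i => ?_
  have := hx i
  rw [rootReflection_apply, sub_eq_self, smul_eq_zero] at this
  rw [inner_zero_left]
  exact this.resolve_right (h.simple_ne_zero i)

/-- The sum over the orbit of `ω k` is W-invariant, hence zero. If the highest element `ω k` had
height ≤ 0, the strictly lower element ω_k - α_k would make the total height negative. -/
theorem weight_pos (k : Fin n) : 0 < φ (ω k) := by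
  have hfin := weylOrbit_finite h.isRootSystem (ω k)
  have hone : ω k ∈ hfin.toFinset := hfin.mem_toFinset.2 ⟨1, Subgroup.one_mem _, rfl⟩
  have hW : ∀ i, rootReflection (α i) ∈ weylGroup Φ :=
    fun i => rootReflection_mem_weylGroup (h.simple_mem_root i)
  have hsum : ∑ r ∈ hfin.toFinset, r = 0 := by
    refine h.eq_zero_of_forall_reflection fun i => ?_
    rw [map_sum]
    refine Finset.sum_nbij' (fun r => rootReflection (α i) r) (fun r => rootReflection (α i) r)
      ?_ ?_ ?_ ?_ ?_
    · intro r hr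
      simp only [hfin.mem_toFinset] at hr ⊢
      exact map_mem_weylOrbit (hW i) hr
    · intro r hr
      simp only [hfin.mem_toFinset] at hr ⊢
      exact map_mem_weylOrbit (hW i) hr
    · intro r _
      exact rootReflection_rootReflection _ _
    · intro r _
      exact rootReflection_rootReflection _ _
    · intro r _
      rfl
  have hlt : φ (rootReflection (α k) (ω k)) < φ (ω k) := by
    rw [rootReflection_apply, h.dual, if_pos rfl, one_smul, map_sub]
    linarith [h.simple_pos k]
  by_contra! hle
  have : ∑ r ∈ hfin.toFinset, φ r < 0 := by
    refine Finset.sum_neg' (fun r hr => ?_) ⟨rootReflection (α k) (ω k), ?_, lt_of_lt_of_le hlt hle⟩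
    · obtain ⟨g, hg, rfl⟩ := hfin.mem_toFinset.1 hr
      exact (h.map_le_of_isDominant (h.isDominant_weight k) hg).trans hle
    · exact hfin.mem_toFinset.2 ⟨_, hW k, rfl⟩
  rw [← map_sum, hsum, map_zero] at this
  exact lt_irrefl _ this

theorem inner_sum_weight_pos {v : RSpace n} (hv : v ∈ positiveRoots Φ φ) :
    0 < inner ℝ (∑ k, ω k) v := by
  have hd : ∀ i, inner ℝ (∑ k, ω k) (coroot (α i)) = 1 := by
    intro i
    simp [sum_inner, h.dual]
  -- The alternative `v = 0` accommodates the base case of the induction.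
  have : v = 0 ∨ 0 < inner ℝ (∑ k, ω k) v := by
    refine h.positive_induction (p := fun v => v = 0 ∨ 0 < inner ℝ (∑ k, ω k) v) (Or.inl rfl)
      (fun i => Or.inr ?_) ?_ hv
    · rw [← inner_coroot_pos_iff (h.simple_ne_zero i), hd]
      exact one_pos
    · rintro x y (rfl | hx) (rfl | hy)
      · simp
      · simp [hy]
      · simp [hx]
      · exact Or.inr (by rw [inner_add_right]; exact add_pos hx hy)
  exact this.resolve_left (h.isRootSystem.ne_zero hv.1)

/-- Choose g maximizing ψ on the orbit of ρ. A ψ-positive root cannot pair negatively with gρ, since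
its reflection would raise ψ; as ρ pairs strictly positively with every φ-positive root, g⁻¹ makes
such a root φ-positive. -/
theorem exists_map_positiveRoots {ψ : RSpace n →ₗ[ℝ] ℝ} (hψ : ∀ v ∈ Φ, ψ v ≠ 0) :
    ∃ g ∈ weylGroup Φ, ∀ v, v ∈ positiveRoots Φ φ ↔ g v ∈ positiveRoots Φ ψ := by
  obtain ⟨_, ⟨g, hg, rfl⟩, hmax⟩ := Set.exists_max_image (weylOrbit Φ (∑ k, ω k)) ψ
    (weylOrbit_finite h.isRootSystem _) ⟨_, 1, Subgroup.one_mem _, rfl⟩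
  have key : ∀ v ∈ positiveRoots Φ ψ, g⁻¹ v ∈ positiveRoots Φ φ := by
    intro v hv
    refine (h.isRootSystem.mem_positiveRoots_or h.ne_zero
      (h.map_mem (Subgroup.inv_mem _ hg) hv.1)).resolve_right fun hneg => ?_
    have h1 := h.inner_sum_weight_pos hneg
    rw [inner_neg_right, real_inner_comm, inner_inv_apply, real_inner_comm] at h1
    have h2 := hmax (rootReflection v (g (∑ k, ω k)))
      ⟨rootReflection v * g, Subgroup.mul_mem _ (rootReflection_mem_weylGroup hv.1) hg, rfl⟩
    rw [rootReflection_apply, map_sub, map_smul, smul_eq_mul] at h2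
    have h3 : 0 ≤ inner ℝ (g (∑ k, ω k)) (coroot v) :=
      nonneg_of_mul_nonneg_left (by linarith) hv.2
    rw [inner_coroot_nonneg_iff (h.isRootSystem.ne_zero hv.1)] at h3
    linarith
  refine ⟨g, hg, fun v => ⟨fun hv => ?_, fun hv => ?_⟩⟩
  · refine (h.isRootSystem.mem_positiveRoots_or hψ (h.map_mem hg hv.1)).resolve_right fun hneg => ?_
    have h1 := (key _ hneg).2
    have h2 : g⁻¹ (-g v) = -v := by rw [map_neg]; exact congrArg _ (g.symm_apply_apply v)
    rw [h2, map_neg] at h1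
    linarith [hv.2]
  · have := key _ hv
    rwa [show g⁻¹ (g v) = v from g.symm_apply_apply v] at this

/-- Two choices of fundamental weights are conjugate under the Weyl group, up to enumeration. -/
theorem exists_perm_weight {φ' : RSpace n →ₗ[ℝ] ℝ} {α' ω' : Fin n → RSpace n}
    (h' : IsWeightSystem Φ φ' α' ω') :
    ∃ g ∈ weylGroup Φ, ∃ σ : Equiv.Perm (Fin n), ∀ k, ω' (σ k) = g (ω k) := by
  obtain ⟨g, hg, hpos⟩ := h.exists_map_positiveRoots h'.ne_zero
  have hinv : ∀ v, g (g⁻¹ v) = v := fun v => g.apply_symm_apply v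
  have hsimple : ∀ k, ∃ j, α' j = g (α k) := by
    intro k
    suffices g (α k) ∈ simpleRoots Φ φ' by rwa [← h'.range_eq] at this
    refine ⟨(hpos _).1 (h.simple_mem_positiveRoots k), ?_⟩
    rintro ⟨v, hv, w, hw, hne, heq⟩
    refine (h.simple_mem k).2 ⟨g⁻¹ v, (hpos _).2 (by rwa [hinv]), g⁻¹ w,
      (hpos _).2 (by rwa [hinv]), fun hx => hne (g⁻¹.injective hx), ?_⟩
    rw [← map_add, ← heq]
    exact (g.symm_apply_apply _).symm
  choose σ hσ using hsimple
  have hσinj : Function.Injective σ := fun a b hab =>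
    h.injective (g.injective (by rw [← hσ, ← hσ, hab]))
  refine ⟨g, hg, Equiv.ofBijective σ (Finite.injective_iff_bijective.1 hσinj), fun k => ?_⟩
  refine h'.ext_coroot fun j => ?_
  obtain ⟨i, rfl⟩ := (Finite.injective_iff_bijective.1 hσinj).2 j
  rw [Equiv.ofBijective_apply, h'.dual, hσ, coroot_map, LinearIsometryEquiv.inner_map_map, h.dual]
  simp [hσinj.eq_iff]

end IsWeightSystem

/-! ### Exponential polynomials and their leading terms. -/

/-- Exponential polynomials with real frequencies. -/
abbrev ExpAlgebra (n : ℕ) : Type := AddMonoidAlgebra ℂ (RSpace n)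

/-- The exponential with frequency `r` and coefficient `c`. -/
noncomputable abbrev expMonomial {n : ℕ} (r : RSpace n) (c : ℂ) : ExpAlgebra n :=
  AddMonoidAlgebra.single r c

theorem coeff_expMonomial_self (r : RSpace n) (c : ℂ) : (expMonomial r c).coeff r = c := by
  simp [AddMonoidAlgebra.coeff_single]

theorem coeff_expMonomial_of_ne {r y : RSpace n} (c : ℂ) (hy : y ≠ r) :
    (expMonomial r c).coeff y = 0 := by
  simp [AddMonoidAlgebra.coeff_single, hy]

/-- The action of linear isometries on exponential polynomials. -/
noncomputable def isometryAct (g : RSpace n ≃ₗᵢ[ℝ] RSpace n) : ExpAlgebra n ≃ₐ[ℂ] ExpAlgebra n :=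
  AddMonoidAlgebra.domCongr ℂ ℂ g.toLinearEquiv.toAddEquiv

theorem coeff_isometryAct (g : RSpace n ≃ₗᵢ[ℝ] RSpace n) (f : ExpAlgebra n) (y : RSpace n) :
    (isometryAct g f).coeff y = f.coeff (g⁻¹ y) :=
  AddMonoidAlgebra.coeff_domCongr _ _ _

theorem isometryAct_expMonomial (g : RSpace n ≃ₗᵢ[ℝ] RSpace n) (r : RSpace n) (c : ℂ) :
    isometryAct g (expMonomial r c) = expMonomial (g r) c :=
  AddMonoidAlgebra.domCongr_single _ _ _

theorem exists_of_coeff_mul_ne_zero {f g : ExpAlgebra n} {y : RSpace n}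
    (h : (f * g).coeff y ≠ 0) : ∃ a b, f.coeff a ≠ 0 ∧ g.coeff b ≠ 0 ∧ y = a + b := by
  classical
  have := AddMonoidAlgebra.support_coeff_mul_subset f g (Finsupp.mem_support_iff.2 h)
  obtain ⟨a, ha, b, hb, hab⟩ := Finset.mem_add.1 this
  exact ⟨a, b, Finsupp.mem_support_iff.1 ha, Finsupp.mem_support_iff.1 hb, hab.symm⟩

/-- The exponential polynomials whose frequencies have height less than `t`. -/
def lowerThan (φ : RSpace n →ₗ[ℝ] ℝ) (t : ℝ) : Submodule ℂ (ExpAlgebra n) where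
  carrier := {f | ∀ y, f.coeff y ≠ 0 → φ y < t}
  zero_mem' := fun y hy => absurd rfl hy
  add_mem' := by
    intro f g hf hg y hy
    by_cases h : f.coeff y = 0
    · refine hg y fun h' => hy ?_
      rw [AddMonoidAlgebra.coeff_add, Finsupp.add_apply, h, h', add_zero]
    · exact hf y h
  smul_mem' := by
    intro c f hf y hy
    refine hf y fun h => hy ?_
    rw [AddMonoidAlgebra.coeff_smul_apply, h, smul_zero]

/-- `f` has leading term `c` at frequency `x`, relative to the height `φ`. -/
def HasLead (φ : RSpace n →ₗ[ℝ] ℝ) (x : RSpace n) (c : ℂ) (f : ExpAlgebra n) : Prop :=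
  f - expMonomial x c ∈ lowerThan φ (φ x)

namespace HasLead

theorem coeff_eq {x : RSpace n} {c : ℂ} {f : ExpAlgebra n} (h : HasLead φ x c f) :
    f.coeff x = c := by
  by_contra hne
  have := h x (by
    rw [AddMonoidAlgebra.coeff_sub, Finsupp.sub_apply, coeff_expMonomial_self]
    exact sub_ne_zero.2 hne)
  exact lt_irrefl _ this

theorem lt_of_ne {x y : RSpace n} {c : ℂ} {f : ExpAlgebra n} (h : HasLead φ x c f)
    (hy : f.coeff y ≠ 0) (hyx : y ≠ x) : φ y < φ x := by
  refine h y ?_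
  rwa [AddMonoidAlgebra.coeff_sub, Finsupp.sub_apply, coeff_expMonomial_of_ne _ hyx, sub_zero]

theorem of_coeff {x : RSpace n} {c : ℂ} {f : ExpAlgebra n} (hx : f.coeff x = c)
    (hf : ∀ y, f.coeff y ≠ 0 → y ≠ x → φ y < φ x) : HasLead φ x c f := by
  intro y hy
  rw [AddMonoidAlgebra.coeff_sub, Finsupp.sub_apply] at hy
  by_cases hyx : y = x
  · subst hyx
    exact absurd (by rw [coeff_expMonomial_self, hx, sub_self]) hy
  · rw [coeff_expMonomial_of_ne _ hyx, sub_zero] at hy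
    exact hf y hy hyx

theorem mul {x y : RSpace n} {c d : ℂ} {f g : ExpAlgebra n} (hf : HasLead φ x c f)
    (hg : HasLead φ y d g) : HasLead φ (x + y) (c * d) (f * g) := by
  have hm : expMonomial (x + y) (c * d) = expMonomial x c * expMonomial y d :=
    (AddMonoidAlgebra.single_mul_single ..).symm
  have hlow : ∀ {s t : ℝ} {f g : ExpAlgebra n}, f ∈ lowerThan φ s → (∀ y, g.coeff y ≠ 0 → φ y ≤ t) →
      f * g ∈ lowerThan φ (s + t) := by
    intro s t f g hf hg z hz
    obtain ⟨a, b, ha, hb, rfl⟩ := exists_of_coeff_mul_ne_zero hz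
    rw [map_add]
    exact add_lt_add_of_lt_of_le (hf a ha) (hg b hb)
  have hmono : ∀ (x : RSpace n) (c : ℂ) (z : RSpace n), (expMonomial x c).coeff z ≠ 0 →
      φ z ≤ φ x := by
    intro x c z hz
    by_cases hzx : z = x
    · rw [hzx]
    · exact absurd (coeff_expMonomial_of_ne c hzx) hz
  have heq : f * g - expMonomial (x + y) (c * d) =
      (f - expMonomial x c) * (g - expMonomial y d) + ((f - expMonomial x c) * expMonomial y d +
        (g - expMonomial y d) * expMonomial x c) := by
    rw [hm]
    ring
  rw [HasLead, heq, map_add]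
  refine add_mem (hlow hf fun z hz => (hg z hz).le) (add_mem (hlow hf (hmono y d)) ?_)
  rw [add_comm (φ x)]
  exact hlow hg (hmono x c)

theorem one : HasLead φ 0 1 (1 : ExpAlgebra n) := by
  rw [HasLead, AddMonoidAlgebra.one_def, sub_self]
  exact zero_mem _

theorem add {x : RSpace n} {c d : ℂ} {f g : ExpAlgebra n} (hf : HasLead φ x c f)
    (hg : HasLead φ x d g) : HasLead φ x (c + d) (f + g) := by
  have : expMonomial x (c + d) = expMonomial x c + expMonomial x d :=
    AddMonoidAlgebra.single_add ..
  rw [HasLead, this, add_sub_add_comm]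
  exact add_mem hf hg

theorem smul {x : RSpace n} {c : ℂ} {f : ExpAlgebra n} (a : ℂ) (hf : HasLead φ x c f) :
    HasLead φ x (a * c) (a • f) := by
  have : expMonomial x (a * c) = a • expMonomial x c := by
    rw [AddMonoidAlgebra.smul_single, smul_eq_mul]
  rw [HasLead, this, ← smul_sub]
  exact Submodule.smul_mem _ _ hf

theorem sum {ι : Type*} {s : Finset ι} {x : RSpace n} {c : ι → ℂ} {f : ι → ExpAlgebra n}
    (hf : ∀ i ∈ s, HasLead φ x (c i) (f i)) : HasLead φ x (∑ i ∈ s, c i) (∑ i ∈ s, f i) := by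
  have : expMonomial x (∑ i ∈ s, c i) = ∑ i ∈ s, expMonomial x (c i) :=
    map_sum (AddMonoidAlgebra.singleAddHom x) _ _
  rw [HasLead, this, ← Finset.sum_sub_distrib]
  exact sum_mem hf

theorem prod {ι : Type*} {s : Finset ι} {x : ι → RSpace n} {c : ι → ℂ} {f : ι → ExpAlgebra n}
    (hf : ∀ i ∈ s, HasLead φ (x i) (c i) (f i)) :
    HasLead φ (∑ i ∈ s, x i) (∏ i ∈ s, c i) (∏ i ∈ s, f i) := by
  classical
  induction s using Finset.induction_on with
  | empty => exact one
  | insert a s ha ih =>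
    rw [Finset.sum_insert ha, Finset.prod_insert ha, Finset.prod_insert ha]
    exact (hf a (Finset.mem_insert_self _ _)).mul
      (ih fun i hi => hf i (Finset.mem_insert_of_mem hi))

theorem pow {x : RSpace n} {c : ℂ} {f : ExpAlgebra n} (hf : HasLead φ x c f) (m : ℕ) :
    HasLead φ (m • x) (c ^ m) (f ^ m) := by
  induction m with
  | zero => simpa using one
  | succ m ih => rw [succ_nsmul, pow_succ, pow_succ]; exact ih.mul hf

/-- Row i leads at `x i`, so every Leibniz term leads at the same frequency ∑ x_i. Individual
leading coefficients are allowed to be zero. -/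
theorem det {x : Fin n → RSpace n} {c : Matrix (Fin n) (Fin n) ℂ}
    {f : Matrix (Fin n) (Fin n) (ExpAlgebra n)} (hf : ∀ i j, HasLead φ (x i) (c i j) (f i j)) :
    HasLead φ (∑ i, x i) c.det f.det := by
  rw [Matrix.det_apply, Matrix.det_apply]
  refine sum fun σ _ => ?_
  have h1 : HasLead φ (∑ i, x i) (∏ i, c (σ i) i) (∏ i, f (σ i) i) := by
    rw [← Equiv.sum_comp σ x]
    exact prod fun i _ => hf (σ i) i
  have h2 := h1.smul ((Equiv.Perm.sign σ : ℤ) : ℂ)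
  convert h2 using 1
  · simp [Units.smul_def]
  · rw [Units.smul_def, ← Int.cast_smul_eq_zsmul ℂ]

end HasLead

/-! ### The weight lattice and orbit sums. -/

/-- The exponential polynomials with frequencies in the subgroup `P`. -/
def latticeSubalgebra (P : AddSubgroup (RSpace n)) : Subalgebra ℂ (ExpAlgebra n) where
  carrier := {f | ∀ y, f.coeff y ≠ 0 → y ∈ P}
  mul_mem' := by
    intro f g hf hg y hy
    obtain ⟨a, b, ha, hb, rfl⟩ := exists_of_coeff_mul_ne_zero hy
    exact P.add_mem (hf a ha) (hg b hb)
  add_mem' := by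
    intro f g hf hg y hy
    by_cases h : f.coeff y = 0
    · refine hg y fun h' => hy ?_
      rw [AddMonoidAlgebra.coeff_add, Finsupp.add_apply, h, h', add_zero]
    · exact hf y h
  algebraMap_mem' := by
    intro c y hy
    by_cases h : y = 0
    · exact h ▸ P.zero_mem
    · exact absurd (coeff_expMonomial_of_ne c h) hy

theorem expMonomial_mem_latticeSubalgebra {P : AddSubgroup (RSpace n)} {r : RSpace n} (hr : r ∈ P)
    (c : ℂ) : expMonomial r c ∈ latticeSubalgebra P := by
  intro y hy
  by_cases h : y = r
  · exact h ▸ hr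
  · exact absurd (coeff_expMonomial_of_ne c h) hy

/-- The sum of the exponentials with frequencies in the orbit of `u`, with coefficients `c`. -/
noncomputable def weightedOrbitSum (Φ : Set (RSpace n)) (u : RSpace n) (c : RSpace n → ℂ) :
    ExpAlgebra n :=
  ∑ᶠ r ∈ weylOrbit Φ u, expMonomial r (c r)

/-- The sum of the exponentials with frequencies in the orbit of `u`. -/
noncomputable abbrev orbitSum (Φ : Set (RSpace n)) (u : RSpace n) : ExpAlgebra n :=
  weightedOrbitSum Φ u fun _ => 1

theorem weightedOrbitSum_eq_sum (h : IsRootSystem Φ) (u : RSpace n) (c : RSpace n → ℂ) :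
    weightedOrbitSum Φ u c = ∑ r ∈ (weylOrbit_finite h u).toFinset, expMonomial r (c r) :=
  finsum_mem_eq_finite_toFinset_sum _ _

theorem coeff_weightedOrbitSum (h : IsRootSystem Φ) (u : RSpace n) (c : RSpace n → ℂ)
    (y : RSpace n) : (weightedOrbitSum Φ u c).coeff y = (weylOrbit Φ u).indicator c y := by
  rw [weightedOrbitSum_eq_sum h, AddMonoidAlgebra.coeff_sum, Finsupp.finsetSum_apply]
  by_cases hy : y ∈ weylOrbit Φ u
  · rw [indicator_of_mem hy, Finset.sum_eq_single y, coeff_expMonomial_self]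
    · exact fun r _ hr => coeff_expMonomial_of_ne _ hr.symm
    · exact fun hn => absurd ((weylOrbit_finite h u).mem_toFinset.2 hy) hn
  · rw [indicator_of_notMem hy]
    refine Finset.sum_eq_zero fun r hr => coeff_expMonomial_of_ne _ ?_
    rintro rfl
    exact hy ((weylOrbit_finite h u).mem_toFinset.1 hr)

theorem isometryAct_weightedOrbitSum (h : IsRootSystem Φ) {g : RSpace n ≃ₗᵢ[ℝ] RSpace n}
    (hg : g ∈ weylGroup Φ) (u : RSpace n) (c : RSpace n → ℂ) :
    isometryAct g (weightedOrbitSum Φ u c) = weightedOrbitSum Φ u fun r => c (g⁻¹ r) := by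
  refine AddMonoidAlgebra.ext (Finsupp.ext fun y => ?_)
  rw [coeff_isometryAct, coeff_weightedOrbitSum h, coeff_weightedOrbitSum h]
  by_cases hy : y ∈ weylOrbit Φ u
  · rw [indicator_of_mem hy, indicator_of_mem (map_mem_weylOrbit (Subgroup.inv_mem _ hg) hy)]
  · rw [indicator_of_notMem hy, indicator_of_notMem]
    intro hy'
    refine hy ?_
    have := map_mem_weylOrbit hg hy'
    rwa [show g (g⁻¹ y) = y from g.apply_symm_apply y] at this

theorem isometryAct_orbitSum (h : IsRootSystem Φ) {g : RSpace n ≃ₗᵢ[ℝ] RSpace n}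
    (hg : g ∈ weylGroup Φ) (u : RSpace n) : isometryAct g (orbitSum Φ u) = orbitSum Φ u :=
  isometryAct_weightedOrbitSum h hg u _

/-- The weight lattice: the vectors that have integral inner product with the simple coroots. -/
def weightLattice (α : Fin n → RSpace n) : AddSubgroup (RSpace n) where
  carrier := {x | ∀ i, ∃ m : ℤ, inner ℝ x (coroot (α i)) = m}
  zero_mem' := fun i => ⟨0, by simp⟩
  add_mem' := by
    intro x y hx hy i
    obtain ⟨a, ha⟩ := hx i
    obtain ⟨b, hb⟩ := hy i
    exact ⟨a + b, by rw [inner_add_left, ha, hb]; push_cast; rfl⟩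
  neg_mem' := by
    intro x hx i
    obtain ⟨a, ha⟩ := hx i
    exact ⟨-a, by rw [inner_neg_left, ha]; push_cast; rfl⟩

namespace IsWeightSystem

variable (h : IsWeightSystem Φ φ α ω)
include h

theorem weight_mem_weightLattice (k : Fin n) : ω k ∈ weightLattice α := by
  intro i
  rw [h.dual]
  exact ⟨if k = i then 1 else 0, by split_ifs <;> simp⟩

theorem root_mem_weightLattice {v : RSpace n} (hv : v ∈ Φ) : v ∈ weightLattice α :=
  fun i => h.isRootSystem.exists_int_inner_coroot (h.simple_mem_root i) hv

/-- A simple reflection subtracts an integral multiple of a root, and roots lie in the lattice by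
integrality. -/
theorem map_mem_weightLattice {g : RSpace n ≃ₗᵢ[ℝ] RSpace n} (hg : g ∈ weylGroup Φ) {x : RSpace n}
    (hx : x ∈ weightLattice α) : g x ∈ weightLattice α := by
  obtain ⟨l, rfl⟩ := h.exists_reflectionWord hg
  clear hg
  induction l with
  | nil => exact hx
  | cons i l ih =>
    have : reflectionWord α (i :: l) x = rootReflection (α i) (reflectionWord α l x) := by
      simp [reflectionWord]
    rw [this, rootReflection_apply]
    obtain ⟨m, hm⟩ := ih i
    rw [hm, Int.cast_smul_eq_zsmul]
    exact AddSubgroup.sub_mem _ ih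
      (AddSubgroup.zsmul_mem _ (h.root_mem_weightLattice (h.simple_mem_root i)) m)

theorem exists_int_inner_coroot {x v : RSpace n} (hx : x ∈ weightLattice α) (hv : v ∈ Φ) :
    ∃ m : ℤ, inner ℝ x (coroot v) = m := by
  obtain ⟨g, hg, i, rfl⟩ := h.exists_map_simple hv
  rw [coroot_map, ← inner_inv_apply]
  exact h.map_mem_weightLattice (Subgroup.inv_mem _ hg) hx i

theorem weightedOrbitSum_mem {u : RSpace n} (hu : u ∈ weightLattice α) (c : RSpace n → ℂ) :
    weightedOrbitSum Φ u c ∈ latticeSubalgebra (weightLattice α) := by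
  intro y hy
  rw [coeff_weightedOrbitSum h.isRootSystem] at hy
  obtain ⟨g, hg, rfl⟩ := mem_of_indicator_ne_zero hy
  exact h.map_mem_weightLattice hg hu

theorem isometryAct_mem {g : RSpace n ≃ₗᵢ[ℝ] RSpace n} (hg : g ∈ weylGroup Φ) {f : ExpAlgebra n}
    (hf : f ∈ latticeSubalgebra (weightLattice α)) :
    isometryAct g f ∈ latticeSubalgebra (weightLattice α) := by
  intro y hy
  rw [coeff_isometryAct] at hy
  have := h.map_mem_weightLattice hg (hf _ hy)
  rwa [show g (g⁻¹ y) = y from g.apply_symm_apply y] at this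

theorem exists_int_sum {x : RSpace n} (hx : x ∈ weightLattice α) :
    ∃ m : Fin n → ℤ, x = ∑ k, m k • ω k := by
  choose m hm using hx
  refine ⟨m, ?_⟩
  conv_lhs => rw [← h.sum_inner_coroot_smul x]
  simp [hm, Int.cast_smul_eq_zsmul]

theorem hasLead_weightedOrbitSum (k : Fin n) (c : RSpace n → ℂ) :
    HasLead φ (ω k) (c (ω k)) (weightedOrbitSum Φ (ω k) c) := by
  refine HasLead.of_coeff ?_ ?_
  · rw [coeff_weightedOrbitSum h.isRootSystem, indicator_of_mem]
    exact ⟨1, Subgroup.one_mem _, rfl⟩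
  · intro y hy hne
    rw [coeff_weightedOrbitSum h.isRootSystem] at hy
    obtain ⟨g, hg, rfl⟩ := mem_of_indicator_ne_zero hy
    exact h.map_lt_of_isDominant (h.isDominant_weight k) hg hne

end IsWeightSystem

/-! ### Invariant and anti-invariant exponential polynomials; the Weyl denominator. -/

/-- The Jacobian determinant of the orbit sums of the fundamental weights, along the simple
coroots. -/
noncomputable def orbitJacobian (Φ : Set (RSpace n)) (α ω : Fin n → RSpace n) : ExpAlgebra n :=
  (Matrix.of fun k j =>
    weightedOrbitSum Φ (ω k) fun r => ((inner ℝ r (coroot (α j)) : ℝ) : ℂ)).det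

theorem coeff_rootReflection (f : ExpAlgebra n) (v y : RSpace n) :
    f.coeff (rootReflection v y) = (isometryAct (rootReflection v) f).coeff y := by
  rw [coeff_isometryAct, rootReflection_inv]

theorem map_sum_nsmul (m : Fin n →₀ ℕ) : φ (∑ k, m k • ω k) = ∑ k, m k * φ (ω k) := by
  simp [map_sum]

theorem weightedOrbitSum_sub_smul (h : IsRootSystem Φ) (u : RSpace n) (c d : RSpace n → ℂ) (a : ℂ) :
    weightedOrbitSum Φ u (fun r => c r - a * d r) =
      weightedOrbitSum Φ u c - a • weightedOrbitSum Φ u d := by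
  refine AddMonoidAlgebra.ext (Finsupp.ext fun y => ?_)
  rw [AddMonoidAlgebra.coeff_sub, Finsupp.sub_apply, AddMonoidAlgebra.coeff_smul_apply]
  simp only [coeff_weightedOrbitSum h]
  by_cases hy : y ∈ weylOrbit Φ u
  · simp [hy]
  · simp [hy]

namespace IsWeightSystem

theorem finite_positiveRoots (h : IsWeightSystem Φ φ α ω) : (positiveRoots Φ φ).Finite :=
  h.isRootSystem.finite_positiveRoots

/-- The Weyl denominator. -/
noncomputable def weylDenominator (h : IsWeightSystem Φ φ α ω) : ExpAlgebra n :=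
  expMonomial (∑ k, ω k) 1 * ∏ v ∈ h.finite_positiveRoots.toFinset, (1 - expMonomial (-v) 1)

variable (h : IsWeightSystem Φ φ α ω)
include h

theorem rootReflection_mem (i : Fin n) : rootReflection (α i) ∈ weylGroup Φ :=
  rootReflection_mem_weylGroup (h.simple_mem_root i)

/-- Only nonvanishing of the reflected coefficients is required, so that the lemma serves both
invariants and anti-invariants. -/
theorem isDominant_of_isMax {f : ExpAlgebra n} {y : RSpace n} (hy : f.coeff y ≠ 0)
    (hmax : ∀ z, f.coeff z ≠ 0 → φ z ≤ φ y)
    (hf : ∀ i, f.coeff (rootReflection (α i) y) ≠ 0 ∨ f.coeff y = 0) : IsDominant α y :=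
  h.isDominant_of_forall_le fun i => hmax _ ((hf i).resolve_right hy)

theorem exists_nat_sum {x : RSpace n} (hx : x ∈ weightLattice α) (hd : IsDominant α x) :
    ∃ m : Fin n →₀ ℕ, x = ∑ k, m k • ω k := by
  choose m hm using hx
  refine ⟨Finsupp.equivFunOnFinite.symm fun k => (m k).toNat, ?_⟩
  conv_lhs => rw [← h.sum_inner_coroot_smul x]
  refine Finset.sum_congr rfl fun k _ => ?_
  have h0 : 0 ≤ m k := by
    have := hd k
    rw [hm] at this
    exact_mod_cast this
  rw [hm, Finsupp.equivFunOnFinite_symm_apply_apply, ← Nat.cast_smul_eq_nsmul ℝ]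
  congr 1
  exact_mod_cast (Int.toNat_of_nonneg h0).symm

theorem sum_nsmul_injective : Function.Injective fun m : Fin n →₀ ℕ => ∑ k, m k • ω k := by
  intro a b hab
  ext j
  have := congrArg (fun x => inner ℝ x (coroot (α j))) hab
  simp only [sum_inner, ← Nat.cast_smul_eq_nsmul ℝ, real_inner_smul_left, h.dual] at this
  simpa using this

/-- Since every φ(ω_k) is positive, a height bound bounds each exponent. This makes the cancellation
of highest terms terminate. -/
theorem finite_setOf_map_le (t : ℝ) : {m : Fin n →₀ ℕ | φ (∑ k, m k • ω k) ≤ t}.Finite := by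
  refine (Set.finite_Iic (Finsupp.equivFunOnFinite.symm fun k => ⌈t / φ (ω k)⌉₊)).subset ?_
  intro m hm k
  rw [mem_ofPred_eq, map_sum_nsmul] at hm
  have hk : (m k : ℝ) * φ (ω k) ≤ t :=
    (Finset.single_le_sum (f := fun k => (m k : ℝ) * φ (ω k))
      (fun j _ => mul_nonneg (Nat.cast_nonneg _) (h.weight_pos j).le) (Finset.mem_univ k)).trans hm
  rw [← le_div_iff₀ (h.weight_pos k)] at hk
  rw [Finsupp.equivFunOnFinite_symm_apply_apply]
  exact_mod_cast hk.trans (Nat.le_ceil _)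

theorem hasLead_monomial (m : Fin n →₀ ℕ) (c : ℂ) :
    HasLead φ (∑ k, m k • ω k) c
      (MvPolynomial.aeval (fun k => orbitSum Φ (ω k)) (MvPolynomial.monomial m c)) := by
  have h1 : HasLead φ (∑ k, m k • ω k) (∏ k : Fin n, (1 : ℂ) ^ m k)
      (∏ k, orbitSum Φ (ω k) ^ m k) :=
    HasLead.prod fun k _ => (h.hasLead_weightedOrbitSum k _).pow (m k)
  have h2 := h1.smul c
  rw [MvPolynomial.aeval_monomial, ← Algebra.smul_def, Finsupp.prod_fintype _ _ (by simp)]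
  simpa using h2

theorem isometryAct_aeval {g : RSpace n ≃ₗᵢ[ℝ] RSpace n} (hg : g ∈ weylGroup Φ)
    (F : MvPolynomial (Fin n) ℂ) :
    isometryAct g (MvPolynomial.aeval (fun k => orbitSum Φ (ω k)) F) =
      MvPolynomial.aeval (fun k => orbitSum Φ (ω k)) F := by
  have := MvPolynomial.comp_aeval_apply (f := fun k => orbitSum Φ (ω k)) (isometryAct g).toAlgHom F
  refine this.trans ?_
  congr 2
  funext k
  exact isometryAct_orbitSum h.isRootSystem hg _

theorem aeval_mem (F : MvPolynomial (Fin n) ℂ) :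
    MvPolynomial.aeval (fun k => orbitSum Φ (ω k)) F ∈ latticeSubalgebra (weightLattice α) := by
  induction F using MvPolynomial.induction_on with
  | C a => rw [MvPolynomial.aeval_C]; exact Subalgebra.algebraMap_mem _ _
  | add p q hp hq => rw [map_add]; exact add_mem hp hq
  | mul_X p i hp =>
    rw [map_mul, MvPolynomial.aeval_X]
    exact mul_mem hp (h.weightedOrbitSum_mem (h.weight_mem_weightLattice i) _)

/-- Invariant exponential polynomials are polynomials in the orbit sums of the fundamental
weights. -/
theorem exists_aeval_eq {f : ExpAlgebra n} (hf : f ∈ latticeSubalgebra (weightLattice α))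
    (hinv : ∀ i, isometryAct (rootReflection (α i)) f = f) :
    ∃ F : MvPolynomial (Fin n) ℂ, MvPolynomial.aeval (fun k => orbitSum Φ (ω k)) F = f := by
  -- The induction measure counts the dominant weights that are frequencies of `f` or lie strictly
  -- below one. It is finite, and it loses `m` when the highest term at `m` is cancelled, as only
  -- lower frequencies are created.
  let E : ExpAlgebra n → Set (Fin n →₀ ℕ) := fun f =>
    {m | (∃ y, f.coeff y ≠ 0 ∧ φ (∑ k, m k • ω k) < φ y) ∨ f.coeff (∑ k, m k • ω k) ≠ 0}
  induction hN : (E f).ncard using Nat.strong_induction_on generalizing f with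
  | _ N ih =>
    by_cases hf0 : f = 0
    · exact ⟨0, by rw [map_zero, hf0]⟩
    have hne : f.coeff.support.Nonempty := Finsupp.support_nonempty_iff.2 fun h0 =>
      hf0 (AddMonoidAlgebra.ext h0)
    obtain ⟨y, hy, hmax⟩ := Finset.exists_max_image f.coeff.support φ hne
    simp only [Finsupp.mem_support_iff] at hy hmax
    have hdom : IsDominant α y := h.isDominant_of_isMax hy hmax fun i => by
      rw [coeff_rootReflection, hinv]
      exact Or.inl hy
    obtain ⟨m, rfl⟩ := h.exists_nat_sum (hf _ hy) hdom
    let G := MvPolynomial.monomial m (f.coeff (∑ k, m k • ω k))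
    have hG := h.hasLead_monomial m (f.coeff (∑ k, m k • ω k))
    let f' := f - MvPolynomial.aeval (fun k => orbitSum Φ (ω k)) G
    have hc : f'.coeff (∑ k, m k • ω k) = 0 := by
      rw [AddMonoidAlgebra.coeff_sub, Finsupp.sub_apply, hG.coeff_eq, sub_self]
    have hs : ∀ z, f'.coeff z ≠ 0 → f.coeff z ≠ 0 ∨ φ z < φ (∑ k, m k • ω k) := by
      intro z hz
      by_contra! hcon
      have hzm : z ≠ ∑ k, m k • ω k := fun hzm => hz (by rw [hzm, hc])
      refine hz ?_
      rw [AddMonoidAlgebra.coeff_sub, Finsupp.sub_apply, hcon.1, zero_sub, neg_eq_zero]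
      by_contra hz'
      exact absurd (hG.lt_of_ne hz' hzm) (not_lt.2 hcon.2)
    have hfinE : (E f).Finite := by
      refine (h.finite_setOf_map_le (φ (∑ k, m k • ω k))).subset ?_
      rintro a (⟨z, hz, hlt⟩ | ha)
      · exact hlt.le.trans (hmax z hz)
      · exact hmax _ ha
    have hsub : E f' ⊂ E f := by
      refine (ssubset_iff_of_subset ?_).2 ⟨m, Or.inr hy, ?_⟩
      · rintro a (⟨z, hz, hlt⟩ | ha)
        · rcases hs z hz with h1 | h1
          · exact Or.inl ⟨z, h1, hlt⟩
          · exact Or.inl ⟨_, hy, hlt.trans h1⟩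
        · rcases hs _ ha with h1 | h1
          · exact Or.inr h1
          · exact Or.inl ⟨_, hy, h1⟩
      · rintro (⟨z, hz, hlt⟩ | ha)
        · rcases hs z hz with h1 | h1
          · exact absurd (hmax z h1) (not_le.2 hlt)
          · exact lt_asymm hlt h1
        · exact ha hc
    obtain ⟨F, hF⟩ := ih (E f').ncard (hN ▸ Set.ncard_lt_ncard hsub hfinE) (f := f')
      (sub_mem hf (h.aeval_mem G))
      (fun i => by rw [map_sub, hinv, h.isometryAct_aeval (h.rootReflection_mem i)]) rfl
    exact ⟨F + G, by rw [map_add, hF, sub_add_cancel]⟩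

/-- The orbit sums of the fundamental weights are algebraically independent. -/
theorem eq_zero_of_aeval_eq_zero {F : MvPolynomial (Fin n) ℂ}
    (hF : MvPolynomial.aeval (fun k => orbitSum Φ (ω k)) F = 0) : F = 0 := by
  by_contra hne
  -- Distinct monomials have distinct leading frequencies, so the leading term of a highest monomial
  -- cannot be cancelled by the others.
  obtain ⟨m, hm, hmax⟩ := Finset.exists_max_image F.support
    (fun m => φ (∑ k, m k • ω k)) (MvPolynomial.support_nonempty.2 hne)
  rw [← MvPolynomial.support_sum_monomial_coeff F, map_sum] at hF
  have hc := congrArg (fun f : ExpAlgebra n => f.coeff (∑ k, m k • ω k)) hF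
  simp only [AddMonoidAlgebra.coeff_sum, Finsupp.finsetSum_apply, AddMonoidAlgebra.coeff_zero,
    Finsupp.zero_apply] at hc
  rw [Finset.sum_eq_single m, (h.hasLead_monomial m _).coeff_eq] at hc
  · exact MvPolynomial.mem_support_iff.1 hm hc
  · intro a ha hne'
    by_contra hx
    have := (h.hasLead_monomial a _).lt_of_ne hx fun heq => hne' (h.sum_nsmul_injective heq).symm
    exact absurd (hmax a ha) (not_le.2 this)
  · exact fun hn => absurd hm hn

/-- A highest frequency y is dominant, and anti-invariance prevents a simple reflection from fixing
it, so it pairs to at least 1 with each simple coroot. As all φ(ω_k) are positive, the height bound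
leaves only y = ρ, where the coefficient is zero. -/
theorem eq_zero_of_isometryAct_eq_neg {f : ExpAlgebra n}
    (hf : f ∈ latticeSubalgebra (weightLattice α))
    (hanti : ∀ i, isometryAct (rootReflection (α i)) f = -f)
    (hle : ∀ y, f.coeff y ≠ 0 → φ y ≤ φ (∑ k, ω k)) (hc : f.coeff (∑ k, ω k) = 0) : f = 0 := by
  by_contra hf0
  have hne : f.coeff.support.Nonempty := Finsupp.support_nonempty_iff.2 fun h0 =>
    hf0 (AddMonoidAlgebra.ext h0)
  obtain ⟨y, hy, hmax⟩ := Finset.exists_max_image f.coeff.support φ hne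
  simp only [Finsupp.mem_support_iff] at hy hmax
  have hanti' : ∀ i, f.coeff (rootReflection (α i) y) = -f.coeff y := by
    intro i
    rw [coeff_rootReflection, hanti, AddMonoidAlgebra.coeff_neg, Finsupp.neg_apply]
  have hdom : IsDominant α y := h.isDominant_of_isMax hy hmax fun i => by
    rw [hanti']
    exact Or.inl (neg_ne_zero.2 hy)
  have hone : ∀ i, 1 ≤ inner ℝ y (coroot (α i)) := by
    intro i
    obtain ⟨m, hm⟩ := hf y hy i
    have hne0 : inner ℝ y (coroot (α i)) ≠ 0 := by
      intro h0
      have := hanti' i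
      rw [rootReflection_apply, h0, zero_smul, sub_zero] at this
      exact hy (self_eq_neg.1 this)
    have hpos := lt_of_le_of_ne (hdom i) hne0.symm
    rw [hm] at hpos ⊢
    exact_mod_cast hpos
  have hyle := hle y hy
  have hall : ∀ i, inner ℝ y (coroot (α i)) = 1 := by
    by_contra! hcon
    obtain ⟨i, hi⟩ := hcon
    rw [← h.sum_inner_coroot_smul y] at hyle
    simp only [map_sum, map_smul, smul_eq_mul] at hyle
    refine absurd hyle (not_le.2 (Finset.sum_lt_sum (fun j _ => ?_) ⟨i, Finset.mem_univ i, ?_⟩))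
    · exact le_mul_of_one_le_left (h.weight_pos j).le (hone j)
    · exact lt_mul_of_one_lt_left (h.weight_pos i) (lt_of_le_of_ne (hone i) hi.symm)
  refine hy ?_
  rw [← h.sum_inner_coroot_smul y]
  simpa [hall] using hc

/-- By duality with the coroots, the matrix of leading coefficients is the identity. -/
theorem hasLead_orbitJacobian : HasLead φ (∑ k, ω k) 1 (orbitJacobian Φ α ω) := by
  have := HasLead.det (φ := φ) (x := ω) (c := 1)
    (f := Matrix.of fun k j =>
      weightedOrbitSum Φ (ω k) fun r => ((inner ℝ r (coroot (α j)) : ℝ) : ℂ)) (fun k j => by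
      have := h.hasLead_weightedOrbitSum k fun r => ((inner ℝ r (coroot (α j)) : ℝ) : ℂ)
      rw [h.dual] at this
      rw [Matrix.one_apply]
      split_ifs with hkj <;> simpa [hkj] using this)
  rwa [Matrix.det_one] at this

theorem orbitJacobian_mem : orbitJacobian Φ α ω ∈ latticeSubalgebra (weightLattice α) := by
  rw [orbitJacobian, Matrix.det_apply]
  refine sum_mem fun σ _ => ?_
  rw [Units.smul_def]
  exact zsmul_mem (prod_mem fun k _ =>
    h.weightedOrbitSum_mem (h.weight_mem_weightLattice _) _) _

theorem isometryAct_orbitJacobian (i : Fin n) :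
    isometryAct (rootReflection (α i)) (orbitJacobian Φ α ω) = -orbitJacobian Φ α ω := by
  let a : Fin n → ℝ := fun j => inner ℝ (α i) (coroot (α j))
  let M : Matrix (Fin n) (Fin n) (ExpAlgebra n) := Matrix.of fun k j =>
    weightedOrbitSum Φ (ω k) fun r => ((inner ℝ r (coroot (α j)) : ℝ) : ℂ)
  let e : Matrix (Fin n) Unit (ExpAlgebra n) := Matrix.of fun j _ => if j = i then 1 else 0
  let b : Matrix Unit (Fin n) (ExpAlgebra n) := Matrix.of fun _ j => algebraMap ℂ _ (a j : ℂ)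
  -- The reflection acts on the Jacobian matrix through a rank-one perturbation of the identity,
  -- whose determinant is 1 - ⟨α_i, α_i^∨⟩ = -1.
  have hM : (isometryAct (rootReflection (α i))).mapMatrix M = M * (1 - e * b) := by
    ext k j : 1
    have hentry : ∀ r, ((inner ℝ (rootReflection (α i) r) (coroot (α j)) : ℝ) : ℂ) =
        ((inner ℝ r (coroot (α j)) : ℝ) : ℂ) -
          (a j : ℂ) * ((inner ℝ r (coroot (α i)) : ℝ) : ℂ) := by
      intro r
      rw [rootReflection_apply, inner_sub_left, real_inner_smul_left]
      push_cast
      ring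
    have hl : (isometryAct (rootReflection (α i))).mapMatrix M k j =
        M k j - (a j : ℂ) • M k i := by
      simp only [AlgEquiv.mapMatrix_apply, Matrix.map_apply, M, Matrix.of_apply]
      rw [isometryAct_weightedOrbitSum h.isRootSystem (h.rootReflection_mem i),
        ← weightedOrbitSum_sub_smul h.isRootSystem, rootReflection_inv]
      simp only [hentry]
    rw [hl, Matrix.mul_sub, Matrix.mul_one, ← Matrix.mul_assoc, Matrix.sub_apply, Matrix.mul_apply]
    congr 1
    simp only [Finset.univ_unique, Finset.sum_singleton, b, Matrix.of_apply, Matrix.mul_apply, e,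
      mul_ite, mul_one, mul_zero, Finset.sum_ite_eq', Finset.mem_univ, if_true]
    rw [mul_comm, Algebra.smul_def]
  have hdet : (1 - e * b).det = -1 := by
    rw [Matrix.det_one_sub_mul_comm, Matrix.det_unique, Matrix.sub_apply, Matrix.one_apply_eq,
      Matrix.mul_apply]
    have ha : a i = 2 := inner_coroot_self (h.simple_ne_zero i)
    simp only [b, e, Matrix.of_apply, mul_ite, mul_one, mul_zero, Finset.sum_ite_eq',
      Finset.mem_univ, if_true, ha]
    push_cast
    rw [map_ofNat]
    norm_num
  change isometryAct (rootReflection (α i)) M.det = -M.det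
  rw [AlgEquiv.map_det, hM, Matrix.det_mul, hdet, mul_neg_one]

/-- The reflection permutes the positive roots other than `α i`; the remaining factor e^ρ (1 -
e^(-α_i)) becomes e^(ρ-α_i) (1 - e^(α_i)), its negative. -/
theorem isometryAct_weylDenominator (i : Fin n) :
    isometryAct (rootReflection (α i)) h.weylDenominator = -h.weylDenominator := by
  classical
  let p := h.finite_positiveRoots.toFinset
  have hmem : ∀ v, v ∈ p ↔ v ∈ positiveRoots Φ φ := fun v => h.finite_positiveRoots.mem_toFinset
  have hi : α i ∈ p := (hmem _).2 (h.simple_mem_positiveRoots i)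
  have hstab : ∀ v ∈ p.erase (α i), rootReflection (α i) v ∈ p.erase (α i) := by
    intro v hv
    rw [Finset.mem_erase, hmem] at hv ⊢
    refine ⟨fun heq => ?_, h.reflection_simple_positive hv.2 hv.1⟩
    have := rootReflection_rootReflection (α i) v
    rw [heq, rootReflection_self] at this
    have h2 := hv.2.2
    rw [← this, map_neg] at h2
    linarith [h.simple_pos i]
  have hprod : isometryAct (rootReflection (α i))
      (∏ v ∈ p.erase (α i), (1 - expMonomial (-v) 1)) =
      ∏ v ∈ p.erase (α i), (1 - expMonomial (-v) 1) := by
    rw [map_prod]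
    refine Finset.prod_nbij' (fun v => rootReflection (α i) v) (fun v => rootReflection (α i) v)
      hstab hstab (fun v _ => rootReflection_rootReflection _ _)
      (fun v _ => rootReflection_rootReflection _ _) (fun v _ => ?_)
    rw [map_sub, map_one, isometryAct_expMonomial, map_neg]
  have hρ : rootReflection (α i) (∑ k, ω k) = ∑ k, ω k + -α i := by
    rw [rootReflection_apply, sub_eq_add_neg]
    simp [sum_inner, h.dual]
  have hmul : ∀ x y : RSpace n, expMonomial (x + y) 1 = expMonomial x 1 * expMonomial y 1 := by
    intro x y
    rw [AddMonoidAlgebra.single_mul_single, one_mul]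
  have hself : expMonomial (-α i) 1 * expMonomial (α i) 1 = 1 := by
    rw [← hmul, neg_add_cancel, AddMonoidAlgebra.one_def]
  rw [weylDenominator, ← Finset.mul_prod_erase p _ hi, map_mul, map_mul, hprod, map_sub, map_one,
    isometryAct_expMonomial, isometryAct_expMonomial, map_neg, rootReflection_self, neg_neg, hρ,
    hmul]
  linear_combination (-expMonomial (∑ k, ω k) 1 *
    ∏ v ∈ p.erase (α i), (1 - expMonomial (-v) 1)) * hself

theorem weylDenominator_mem : h.weylDenominator ∈ latticeSubalgebra (weightLattice α) := by
  refine mul_mem (expMonomial_mem_latticeSubalgebra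
    (sum_mem fun k _ => h.weight_mem_weightLattice k) 1) (prod_mem fun v hv => ?_)
  refine sub_mem (one_mem _) (expMonomial_mem_latticeSubalgebra (neg_mem ?_) 1)
  exact h.root_mem_weightLattice (h.finite_positiveRoots.mem_toFinset.1 hv).1

theorem hasLead_weylDenominator : HasLead φ (∑ k, ω k) 1 h.weylDenominator := by
  have h1 : HasLead φ (∑ k, ω k) 1 (expMonomial (∑ k, ω k) 1) := by
    rw [HasLead, sub_self]
    exact zero_mem _
  have h2 : HasLead φ (∑ v ∈ h.finite_positiveRoots.toFinset, (0 : RSpace n))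
      (∏ v ∈ h.finite_positiveRoots.toFinset, (1 : ℂ))
      (∏ v ∈ h.finite_positiveRoots.toFinset, (1 - expMonomial (-v) 1)) := by
    refine HasLead.prod fun v hv => ?_
    intro y hy
    rw [AddMonoidAlgebra.one_def, sub_sub_cancel_left, AddMonoidAlgebra.coeff_neg,
      Finsupp.neg_apply, neg_ne_zero] at hy
    have hyv : y = -v := by
      by_contra hne
      exact hy (coeff_expMonomial_of_ne 1 hne)
    rw [hyv, map_neg, map_zero, neg_lt_zero]
    exact (h.finite_positiveRoots.mem_toFinset.1 hv).2
  have := h1.mul h2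
  simpa [weylDenominator] using this

theorem orbitJacobian_eq : orbitJacobian Φ α ω = h.weylDenominator := by
  rw [← sub_eq_zero]
  have hJ := h.hasLead_orbitJacobian
  have hD := h.hasLead_weylDenominator
  refine h.eq_zero_of_isometryAct_eq_neg (sub_mem h.orbitJacobian_mem h.weylDenominator_mem)
    (fun i => ?_) (fun y hy => ?_) ?_
  · rw [map_sub, h.isometryAct_orbitJacobian, h.isometryAct_weylDenominator]
    abel
  · by_cases hyr : y = ∑ k, ω k
    · rw [hyr]
    · rw [AddMonoidAlgebra.coeff_sub, Finsupp.sub_apply] at hy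
      by_cases hJy : (orbitJacobian Φ α ω).coeff y = 0
      · rw [hJy, zero_sub, neg_ne_zero] at hy
        exact (hD.lt_of_ne hy hyr).le
      · exact (hJ.lt_of_ne hJy hyr).le
  · rw [AddMonoidAlgebra.coeff_sub, Finsupp.sub_apply, hJ.coeff_eq, hD.coeff_eq, sub_self]

end IsWeightSystem

/-! ### Evaluation at points and the critical locus of the generalized cosine. -/

theorem inner_toComplex (r : RSpace n) (x : CSpace n) :
    inner ℂ (toComplex r) x = ∑ i, (r i : ℂ) * x i := by
  simp [toComplex, PiLp.inner_apply, mul_comm]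

theorem toComplex_add (r s : RSpace n) : toComplex (r + s) = toComplex r + toComplex s := by
  ext i
  simp [toComplex]

theorem toComplex_smul (c : ℝ) (r : RSpace n) : toComplex (c • r) = (c : ℂ) • toComplex r := by
  ext i
  simp [toComplex]

theorem toComplex_neg (r : RSpace n) : toComplex (-r) = -toComplex r := by
  ext i
  simp [toComplex]

theorem inner_toComplex_toComplex (r s : RSpace n) :
    inner ℂ (toComplex r) (toComplex s) = ((inner ℝ r s : ℝ) : ℂ) := by
  rw [inner_toComplex]
  simp [toComplex, PiLp.inner_apply, mul_comm]

/-- The value of an exponential polynomial at a point. -/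
noncomputable def expEval (x : CSpace n) : ExpAlgebra n →ₐ[ℂ] ℂ :=
  AddMonoidAlgebra.lift ℂ ℂ (RSpace n)
    { toFun := fun r => Complex.exp (2 * Real.pi * Complex.I * inner ℂ (toComplex r.toAdd) x)
      map_one' := by rw [toAdd_one, inner_toComplex]; simp
      map_mul' := by
        intro r s
        rw [toAdd_mul, toComplex_add, inner_add_left, mul_add, Complex.exp_add] }

theorem expEval_expMonomial (x : CSpace n) (r : RSpace n) (c : ℂ) :
    expEval x (expMonomial r c) =
      c * Complex.exp (2 * Real.pi * Complex.I * inner ℂ (toComplex r) x) :=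
  AddMonoidAlgebra.lift_single _ _ _

theorem expEval_weightedOrbitSum (h : IsRootSystem Φ) (x : CSpace n) (u : RSpace n)
    (c : RSpace n → ℂ) : expEval x (weightedOrbitSum Φ u c) =
      ∑ r ∈ (weylOrbit_finite h u).toFinset,
        c r * Complex.exp (2 * Real.pi * Complex.I * inner ℂ (toComplex r) x) := by
  rw [weightedOrbitSum_eq_sum h, map_sum]
  simp only [expEval_expMonomial]

theorem generalizedCosine_apply (h : IsRootSystem Φ) (x : CSpace n) (k : Fin n) :
    generalizedCosine Φ ω x k = expEval x (orbitSum Φ (ω k)) := by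
  rw [expEval_weightedOrbitSum h]
  simp only [one_mul]
  exact finsum_mem_eq_finite_toFinset_sum _ _

/-- The factor `d` moves from the point to the frequencies, because the orbit of `d u` is `d` times
the orbit of `u`. -/
theorem expEval_natCast_smul (h : IsRootSystem Φ) {d : ℕ} (hd : d ≠ 0) (x : CSpace n)
    (u : RSpace n) :
    expEval ((d : ℂ) • x) (orbitSum Φ u) = expEval x (orbitSum Φ ((d : ℝ) • u)) := by
  have hd' : (d : ℝ) ≠ 0 := Nat.cast_ne_zero.2 hd
  rw [expEval_weightedOrbitSum h, expEval_weightedOrbitSum h]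
  refine Finset.sum_nbij (fun r => (d : ℝ) • r) ?_ ?_ ?_ ?_
  · intro r hr
    simp only [Finite.mem_toFinset] at hr ⊢
    obtain ⟨g, hg, rfl⟩ := hr
    exact ⟨g, hg, by rw [map_smul]⟩
  · intro r _ s _ hrs
    exact smul_right_injective _ hd' hrs
  · intro r hr
    simp only [Finset.mem_coe, Finite.mem_toFinset] at hr
    obtain ⟨g, hg, rfl⟩ := hr
    exact ⟨g u, by simpa using ⟨g, hg, rfl⟩, by simp⟩
  · intro r _
    rw [toComplex_smul, inner_smul_left, inner_smul_right]
    simp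

theorem hasFDerivAt_generalizedCosine_apply (h : IsRootSystem Φ) (x : CSpace n) (k : Fin n) :
    HasFDerivAt (fun x => generalizedCosine Φ ω x k)
      (∑ r ∈ (weylOrbit_finite h (ω k)).toFinset,
        Complex.exp (2 * Real.pi * Complex.I * inner ℂ (toComplex r) x) •
          ((2 * Real.pi * Complex.I) • innerSL ℂ (toComplex r))) x := by
  simp only [generalizedCosine_apply h, expEval_weightedOrbitSum h, one_mul]
  refine HasFDerivAt.fun_sum fun r _ => ?_
  exact (((innerSL ℂ (toComplex r)).hasFDerivAt (x := x)).const_mul _).cexp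

theorem differentiable_generalizedCosine (h : IsRootSystem Φ) :
    Differentiable ℂ (generalizedCosine Φ ω) := by
  rw [differentiable_euclidean]
  exact fun k x => (hasFDerivAt_generalizedCosine_apply h x k).differentiableAt

theorem fderiv_generalizedCosine_toComplex (h : IsRootSystem Φ) (x : CSpace n) (u : RSpace n)
    (k : Fin n) : fderiv ℂ (generalizedCosine Φ ω) x (toComplex u) k =
      2 * Real.pi * Complex.I *
        expEval x (weightedOrbitSum Φ (ω k) fun r => ((inner ℝ r u : ℝ) : ℂ)) := by
  have h1 := ((EuclideanSpace.proj k : CSpace n →L[ℂ] ℂ).hasFDerivAt).comp x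
    (differentiable_generalizedCosine (ω := ω) h x).hasFDerivAt
  have h2 := congrArg (fun L => L (toComplex u))
    (h1.unique (hasFDerivAt_generalizedCosine_apply h x k))
  refine Eq.trans ?_ (h2.trans ?_)
  · rfl
  · rw [expEval_weightedOrbitSum h, Finset.mul_sum, sum_apply]
    refine Finset.sum_congr rfl fun r _ => ?_
    simp only [smul_apply, innerSL_apply_apply, inner_toComplex_toComplex,
      smul_eq_mul]
    ring

namespace IsWeightSystem

variable (h : IsWeightSystem Φ φ α ω)
include h

/-- Differentiating along the simple coroots gives (2πi) times the Jacobian matrix of orbit sums.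
The change of basis is inverted by the matrix of weights, and c = det Ω · (2πi)^n. -/
theorem exists_det_fderiv_eq : ∃ c : ℂ, c ≠ 0 ∧ ∀ x : CSpace n,
    (fderiv ℂ (generalizedCosine Φ ω) x).det = c * expEval x (orbitJacobian Φ α ω) := by
  let b := (EuclideanSpace.basisFun (Fin n) ℂ).toBasis
  let A : Matrix (Fin n) (Fin n) ℂ := Matrix.of fun i j => (coroot (α j) i : ℂ)
  let Ω : Matrix (Fin n) (Fin n) ℂ := Matrix.of fun j i => (ω j i : ℂ)
  have hΩ : Ω * A = 1 := by
    ext j k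
    have := inner_toComplex_toComplex (ω j) (coroot (α k))
    rw [inner_toComplex, h.dual] at this
    rw [Matrix.mul_apply, Matrix.one_apply]
    refine Eq.trans this ?_
    split_ifs <;> simp
  have hdet : Ω.det * A.det = 1 := by rw [← Matrix.det_mul, hΩ, Matrix.det_one]
  refine ⟨Ω.det * (2 * Real.pi * Complex.I) ^ n,
    mul_ne_zero (left_ne_zero_of_mul_eq_one hdet) (pow_ne_zero _ Complex.two_pi_I_ne_zero), ?_⟩
  intro x
  let D : CSpace n →ₗ[ℂ] CSpace n := (fderiv ℂ (generalizedCosine Φ ω) x : CSpace n →ₗ[ℂ] CSpace n)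
  let M : Matrix (Fin n) (Fin n) (ExpAlgebra n) := Matrix.of fun k j =>
    weightedOrbitSum Φ (ω k) fun r => ((inner ℝ r (coroot (α j)) : ℝ) : ℂ)
  have hN : LinearMap.toMatrix b b D * A =
      (2 * Real.pi * Complex.I) • (expEval x).mapMatrix M := by
    ext k j
    have h1 := congrFun (LinearMap.toMatrix_mulVec_repr b b D (toComplex (coroot (α j)))) k
    have h2 := fderiv_generalizedCosine_toComplex (ω := ω) h.isRootSystem x (coroot (α j)) k
    rw [Matrix.mul_apply]
    refine Eq.trans ?_ (h1.trans (Eq.trans ?_ h2))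
    · rfl
    · simp [b, D]
  have hJ : expEval x (orbitJacobian Φ α ω) = ((expEval x).mapMatrix M).det :=
    AlgHom.map_det _ _
  have hD : (fderiv ℂ (generalizedCosine Φ ω) x).det = (LinearMap.toMatrix b b D).det :=
    (LinearMap.det_toMatrix b D).symm
  have := congrArg Matrix.det hN
  rw [Matrix.det_mul, Matrix.det_smul, Fintype.card_fin, ← hJ, ← hD] at this
  calc (fderiv ℂ (generalizedCosine Φ ω) x).det
      = Ω.det * ((fderiv ℂ (generalizedCosine Φ ω) x).det * A.det) := by
        linear_combination -(fderiv ℂ (generalizedCosine Φ ω) x).det * hdet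
    _ = _ := by rw [this, ← mul_assoc]

theorem expEval_weylDenominator (x : CSpace n) : expEval x h.weylDenominator =
    Complex.exp (2 * Real.pi * Complex.I * inner ℂ (toComplex (∑ k, ω k)) x) *
      ∏ v ∈ h.finite_positiveRoots.toFinset,
        (1 - Complex.exp (2 * Real.pi * Complex.I * -inner ℂ (toComplex v) x)) := by
  rw [weylDenominator, map_mul, map_prod]
  simp only [map_sub, map_one, expEval_expMonomial, one_mul, toComplex_neg, inner_neg_left]

theorem mem_cartanStiefelDiagram_iff (x : CSpace n) : x ∈ cartanStiefelDiagram Φ ↔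
    ∃ v ∈ positiveRoots Φ φ, ∃ l : ℤ, inner ℂ (toComplex v) x = l := by
  simp only [cartanStiefelDiagram, complexHyperplane, mem_iUnion, mem_ofPred_eq]
  constructor
  · rintro ⟨v, hv, l, hl⟩
    rcases h.isRootSystem.mem_positiveRoots_or h.ne_zero hv with h1 | h1
    · exact ⟨v, h1, l, by simpa using hl⟩
    · exact ⟨-v, h1, -l, by rw [toComplex_neg, inner_neg_left, hl]; simp⟩
  · rintro ⟨v, hv, l, hl⟩
    exact ⟨v, hv.1, l, by simpa using hl⟩

theorem expEval_weylDenominator_eq_zero_iff (x : CSpace n) :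
    expEval x h.weylDenominator = 0 ↔ x ∈ cartanStiefelDiagram Φ := by
  rw [h.expEval_weylDenominator, h.mem_cartanStiefelDiagram_iff,
    mul_eq_zero_iff_left (Complex.exp_ne_zero _), Finset.prod_eq_zero_iff]
  simp only [Finite.mem_toFinset, sub_eq_zero, eq_comm (a := (1 : ℂ)), Complex.exp_eq_one_iff]
  refine exists_congr fun v => and_congr_right fun _ => ?_
  constructor
  · rintro ⟨l, hl⟩
    refine ⟨-l, mul_left_cancel₀ Complex.two_pi_I_ne_zero ?_⟩
    push_cast
    linear_combination -hl
  · rintro ⟨l, hl⟩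
    exact ⟨-l, by rw [hl]; push_cast; ring⟩

theorem criticalLocus_generalizedCosine :
    criticalLocus (generalizedCosine Φ ω) = cartanStiefelDiagram Φ := by
  obtain ⟨c, hc, hdet⟩ := h.exists_det_fderiv_eq
  ext x
  rw [← h.expEval_weylDenominator_eq_zero_iff, ← h.orbitJacobian_eq]
  change (fderiv ℂ (generalizedCosine Φ ω) x).det = 0 ↔ _
  rw [hdet, mul_eq_zero_iff_left hc]

/-! ### Surjectivity of the generalized cosine. -/

theorem exists_aeval_eq_sum_isometryAct [Fintype (weylGroup Φ)] {f : ExpAlgebra n}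
    (hf : f ∈ latticeSubalgebra (weightLattice α)) :
    ∃ F : MvPolynomial (Fin n) ℂ, MvPolynomial.aeval (fun k => orbitSum Φ (ω k)) F =
      ∑ g : weylGroup Φ, isometryAct g.1 f := by
  refine h.exists_aeval_eq (sum_mem fun g _ => h.isometryAct_mem g.2 hf) fun i => ?_
  rw [map_sum]
  refine Fintype.sum_equiv (Equiv.mulLeft ⟨_, h.rootReflection_mem i⟩) _ _ fun g => ?_
  refine AddMonoidAlgebra.ext (Finsupp.ext fun y => ?_)
  simp only [coeff_isometryAct, Equiv.coe_mulLeft, Subgroup.coe_mul, mul_inv_rev,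
    LinearIsometryEquiv.coe_mul, Function.comp_apply]

/-- Prescribing the values of the orbit sums of the fundamental weights never generates the unit
ideal. -/
theorem sum_mul_orbitSum_sub_ne_one (c : Fin n → ℂ) (f : Fin n → ExpAlgebra n)
    (hf : ∀ k, f k ∈ latticeSubalgebra (weightLattice α)) :
    ∑ k, f k * (orbitSum Φ (ω k) - algebraMap ℂ _ (c k)) ≠ 1 := by
  intro hone
  have := (weylGroup_finite h.isRootSystem).fintype
  choose F hF using fun k => h.exists_aeval_eq_sum_isometryAct (hf k)
  -- Averaging the relation over W replaces the coefficients by polynomials in the orbit sums.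
  -- Algebraic independence then gives ∑ F_k (X_k - c_k) = |W|, which is absurd at the point c.
  have key : MvPolynomial.aeval (fun k => orbitSum Φ (ω k))
      (∑ k, F k * (MvPolynomial.X k - MvPolynomial.C (c k)) -
        MvPolynomial.C (Fintype.card (weylGroup Φ) : ℂ)) = 0 := by
    rw [map_sub, map_sum, sub_eq_zero]
    simp only [map_mul, map_sub, MvPolynomial.aeval_X, MvPolynomial.aeval_C, hF, Finset.sum_mul]
    rw [Finset.sum_comm]
    have : ∀ g : weylGroup Φ, ∑ k, isometryAct g.1 (f k) *
        (orbitSum Φ (ω k) - algebraMap ℂ (ExpAlgebra n) (c k)) = 1 := by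
      intro g
      rw [← map_one (isometryAct g.1), ← hone, map_sum]
      simp only [map_mul, map_sub, isometryAct_orbitSum h.isRootSystem g.2, AlgEquiv.commutes]
    simp only [this]
    simp
  have := congrArg (MvPolynomial.eval c) (h.eq_zero_of_aeval_eq_zero key)
  simp at this

/-- Exponential polynomials with frequencies in the weight lattice, written in terms of the basis
of fundamental weights. -/
theorem exists_mapDomain_eq {f : ExpAlgebra n} (hf : f ∈ latticeSubalgebra (weightLattice α))
    {j : (Fin n → ℤ) →+ RSpace n} (hj : ∀ m, j m = ∑ k, m k • ω k) :
    ∃ b, AddMonoidAlgebra.mapDomainAlgHom ℂ ℂ j b = f := by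
  have hsum := AddMonoidAlgebra.sum_coeff_single f
  rw [← AlgHom.mem_range, ← hsum]
  refine sum_mem fun y hy => ?_
  obtain ⟨m, hm⟩ := h.exists_int_sum (hf y (Finsupp.mem_support_iff.1 hy))
  refine ⟨AddMonoidAlgebra.single m (f.coeff y), ?_⟩
  rw [hm, ← hj]
  exact AddMonoidAlgebra.mapDomain_single

theorem mapDomain_mem {j : (Fin n → ℤ) →+ RSpace n} (hj : ∀ m, j m = ∑ k, m k • ω k)
    (b : AddMonoidAlgebra ℂ (Fin n → ℤ)) :
    AddMonoidAlgebra.mapDomainAlgHom ℂ ℂ j b ∈ latticeSubalgebra (weightLattice α) := by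
  induction b using AddMonoidAlgebra.induction_linear with
  | zero => rw [map_zero]; exact zero_mem _
  | add f g hf hg => rw [map_add]; exact add_mem hf hg
  | single m c =>
    have : AddMonoidAlgebra.mapDomainAlgHom ℂ ℂ j (AddMonoidAlgebra.single m c) =
      expMonomial (j m) c := AddMonoidAlgebra.mapDomain_single
    rw [this, hj]
    exact expMonomial_mem_latticeSubalgebra
      (sum_mem fun k _ => zsmul_mem (h.weight_mem_weightLattice k) _) c

end IsWeightSystem

/-- A proper ideal of a finitely generated algebra over `ℂ` has a zero. -/
theorem exists_algHom_of_ne_top {B : Type*} [CommRing B] [Algebra ℂ B] [Algebra.FiniteType ℂ B]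
    {I : Ideal B} (hI : I ≠ ⊤) : ∃ χ : B →ₐ[ℂ] ℂ, ∀ b ∈ I, χ b = 0 := by
  obtain ⟨M, hM, hIM⟩ := Ideal.exists_le_maximal I hI
  let _ : Field (B ⧸ M) := Ideal.Quotient.field M
  -- Zariski's lemma: the residue field is finite over ℂ, hence equal to ℂ.
  have : Module.Finite ℂ (B ⧸ M) := finite_of_finite_type_of_isJacobsonRing ℂ (B ⧸ M)
  let e : ℂ ≃ₐ[ℂ] B ⧸ M := AlgEquiv.ofBijective (Algebra.ofId ℂ (B ⧸ M))
    IsAlgClosed.algebraMap_bijective_of_isIntegral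
  refine ⟨e.symm.toAlgHom.comp (Ideal.Quotient.mkₐ ℂ M), fun b hb => ?_⟩
  have : Ideal.Quotient.mkₐ ℂ M b = 0 := Ideal.Quotient.eq_zero_iff_mem.2 (hIM hb)
  rw [AlgHom.comp_apply, this, map_zero]

namespace IsWeightSystem

variable (h : IsWeightSystem Φ φ α ω)
include h

/-- A character takes nonzero values on the group generators; their logarithms divided by 2πi are
the coordinates of `x` along the simple coroots. -/
theorem exists_expEval_eq {j : (Fin n → ℤ) →+ RSpace n} (hj : ∀ m, j m = ∑ k, m k • ω k)
    (χ : AddMonoidAlgebra ℂ (Fin n → ℤ) →ₐ[ℂ] ℂ) :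
    ∃ x : CSpace n, (expEval x).comp (AddMonoidAlgebra.mapDomainAlgHom ℂ ℂ j) = χ := by
  classical
  have hχ : ∀ k : Fin n, ∃ z : ℂ, Complex.exp (2 * Real.pi * Complex.I * z) =
      χ (AddMonoidAlgebra.single (Pi.single k 1) 1) := by
    intro k
    have hne : χ (AddMonoidAlgebra.single (Pi.single k 1) 1) ≠ 0 := by
      intro h0
      have h1 : (AddMonoidAlgebra.single (Pi.single k 1) 1 : AddMonoidAlgebra ℂ (Fin n → ℤ)) *
          AddMonoidAlgebra.single (-Pi.single k 1) 1 = 1 := by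
        rw [AddMonoidAlgebra.single_mul_single, add_neg_cancel, one_mul, AddMonoidAlgebra.one_def]
      have := congrArg χ h1
      rw [map_mul, h0, zero_mul, map_one] at this
      exact zero_ne_one this
    refine ⟨Complex.log (χ (AddMonoidAlgebra.single (Pi.single k 1) 1)) /
      (2 * Real.pi * Complex.I), ?_⟩
    rw [mul_div_cancel₀ _ Complex.two_pi_I_ne_zero, Complex.exp_log hne]
  choose z hz using hχ
  refine ⟨∑ k, z k • toComplex (coroot (α k)), ?_⟩
  have hinner : ∀ k, inner ℂ (toComplex (ω k)) (∑ i, z i • toComplex (coroot (α i))) = z k := by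
    intro k
    simp [inner_toComplex_toComplex, h.dual, apply_ite]
  refine AddMonoidAlgebra.algHom_ext' ?_ (Subsingleton.elim _ _)
  refine MonoidHom.toAdditiveRight.injective ?_
  refine AddMonoidHom.functions_ext' _ _ _ fun k => AddMonoidHom.ext_int ?_
  change expEval _ (AddMonoidAlgebra.mapDomainAlgHom ℂ ℂ j
    (AddMonoidAlgebra.single (Pi.single k 1) 1)) = χ (AddMonoidAlgebra.single (Pi.single k 1) 1)
  have hjk : j (Pi.single k 1) = ω k := by
    rw [hj, Finset.sum_eq_single k (fun i _ hi => by simp [hi]) (by simp)]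
    simp
  have hs : AddMonoidAlgebra.mapDomainAlgHom ℂ ℂ j (AddMonoidAlgebra.single (Pi.single k 1) 1) =
      expMonomial (j (Pi.single k 1)) 1 := AddMonoidAlgebra.mapDomain_single
  rw [hs, hjk, expEval_expMonomial, hinner, hz, one_mul]

theorem surjective_generalizedCosine : Function.Surjective (generalizedCosine Φ ω) := by
  intro c
  -- The ideal is formed in the group algebra of ℤ^n, which is finitely generated, so that the
  -- Nullstellensatz applies.
  let j : (Fin n → ℤ) →+ RSpace n :=
    { toFun := fun m => ∑ k, m k • ω k
      map_zero' := by simp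
      map_add' := fun a b => by simp [add_smul, Finset.sum_add_distrib] }
  have hj : ∀ m, j m = ∑ k, m k • ω k := fun _ => rfl
  choose b hb using fun k => h.exists_mapDomain_eq
    (h.weightedOrbitSum_mem (h.weight_mem_weightLattice k) fun _ => 1) hj
  let I := Ideal.span (range fun k => b k - algebraMap ℂ _ (c k))
  have hI : I ≠ ⊤ := by
    rw [Ideal.ne_top_iff_one]
    intro hone
    obtain ⟨f, hf⟩ := (Ideal.mem_span_range_iff_exists_fun).1 hone
    refine h.sum_mul_orbitSum_sub_ne_one (fun k => c k)
      (fun k => AddMonoidAlgebra.mapDomainAlgHom ℂ ℂ j (f k)) (fun k => h.mapDomain_mem hj _) ?_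
    have := congrArg (AddMonoidAlgebra.mapDomainAlgHom ℂ ℂ j) hf
    rw [map_sum, map_one] at this
    simpa only [map_mul, map_sub, hb, AlgHom.commutes] using this
  obtain ⟨χ, hχ⟩ := exists_algHom_of_ne_top hI
  obtain ⟨x, hx⟩ := h.exists_expEval_eq hj χ
  refine ⟨x, ?_⟩
  ext k
  rw [generalizedCosine_apply h.isRootSystem, orbitSum, ← hb, ← AlgHom.comp_apply, hx]
  have := hχ _ (Ideal.subset_span (mem_range_self k))
  rw [map_sub, sub_eq_zero, AlgHom.commutes] at this
  exact this

end IsWeightSystem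

/-! ### Chebyshev-like maps: existence, Jacobian and post-critical locus. -/

theorem expEval_aeval (h : IsRootSystem Φ) (x : CSpace n) (F : MvPolynomial (Fin n) ℂ) :
    expEval x (MvPolynomial.aeval (fun k => orbitSum Φ (ω k)) F) =
      MvPolynomial.eval (fun k => generalizedCosine Φ ω x k) F := by
  have := MvPolynomial.comp_aeval_apply (f := fun k => orbitSum Φ (ω k)) (expEval x) F
  rw [this, ← MvPolynomial.coe_aeval_eq_eval]
  simp only [generalizedCosine_apply h]
  rfl

theorem IsPolynomialMap.contDiff {f : CSpace n → CSpace n} (hf : IsPolynomialMap f) :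
    ContDiff ℂ 1 f := by
  obtain ⟨p, hp⟩ := hf
  rw [contDiff_euclidean]
  intro i
  simp only [hp]
  induction p i using MvPolynomial.induction_on with
  | C a => simpa using contDiff_const
  | add p q hp hq => simpa only [map_add] using hp.add hq
  | mul_X p j hp =>
    simp only [map_mul, MvPolynomial.eval_X]
    exact hp.mul (EuclideanSpace.proj j : CSpace n →L[ℂ] ℂ).contDiff

theorem iterate_generalizedCosine {d : ℕ} {T : CSpace n → CSpace n}
    (hT : IsChebyshevLike Φ ω d T) (k : ℕ) (x : CSpace n) :
    T^[k] (generalizedCosine Φ ω x) = generalizedCosine Φ ω (((d ^ k : ℕ) : ℂ) • x) := by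
  induction k with
  | zero => simp
  | succ k ih =>
    rw [Function.iterate_succ_apply', ih, hT, smul_smul, pow_succ']
    push_cast
    rfl

theorem natCast_smul_mem_cartanStiefelDiagram {x : CSpace n} (hx : x ∈ cartanStiefelDiagram Φ)
    (d : ℕ) : (d : ℂ) • x ∈ cartanStiefelDiagram Φ := by
  simp only [cartanStiefelDiagram, complexHyperplane, mem_iUnion, mem_ofPred_eq] at hx ⊢
  obtain ⟨v, hv, l, hl⟩ := hx
  exact ⟨v, hv, d * l, by rw [inner_smul_right, hl]; push_cast; rfl⟩

/-- Translation by m v^∨ changes ⟨v, x⟩ by 2m, so only the parity of `l` matters: odd `l` moves to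
1, even `l` to 2, which is 1 · 2^1 if d = 2 and is itself not divisible by d if d > 2. -/
theorem exists_add_two_mul_eq {d : ℕ} (hd : 2 ≤ d) (l : ℤ) :
    ∃ (m : ℤ) (k a : ℕ), l + 2 * m = a * (d : ℤ) ^ k ∧ ¬ d ∣ a := by
  rcases Int.even_or_odd' l with ⟨c, rfl | rfl⟩
  · rcases hd.eq_or_lt with rfl | hd
    · exact ⟨1 - c, 1, 1, by push_cast; ring, by norm_num⟩
    · exact ⟨1 - c, 0, 2, by push_cast; ring, Nat.not_dvd_of_pos_of_lt two_pos hd⟩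
  · exact ⟨-c, 0, 1, by push_cast; ring, Nat.not_dvd_of_pos_of_lt one_pos hd⟩

namespace IsWeightSystem

variable (h : IsWeightSystem Φ φ α ω)
include h

theorem exists_isChebyshevLike {d : ℕ} (hd : d ≠ 0) :
    ∃ T : CSpace n → CSpace n, IsPolynomialMap T ∧ IsChebyshevLike Φ ω d T := by
  have hmem : ∀ k, (d : ℝ) • ω k ∈ weightLattice α := fun k => by
    rw [Nat.cast_smul_eq_nsmul]
    exact nsmul_mem (h.weight_mem_weightLattice k) d
  choose F hF using fun k => h.exists_aeval_eq (h.weightedOrbitSum_mem (hmem k) fun _ => 1)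
    fun i => isometryAct_orbitSum h.isRootSystem (h.rootReflection_mem i) _
  refine ⟨fun z => WithLp.toLp 2 fun k => MvPolynomial.eval (fun j => z j) (F k),
    ⟨F, fun z i => rfl⟩, fun x => ?_⟩
  ext k
  rw [generalizedCosine_apply h.isRootSystem, expEval_natCast_smul h.isRootSystem hd, orbitSum,
    ← hF, expEval_aeval h.isRootSystem]

theorem isChebyshevLike_unique {d : ℕ} {T T' : CSpace n → CSpace n}
    (hT : IsChebyshevLike Φ ω d T) (hT' : IsChebyshevLike Φ ω d T') : T = T' := by
  funext z
  obtain ⟨x, rfl⟩ := h.surjective_generalizedCosine z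
  rw [hT, hT']

theorem isPolynomialMap {d : ℕ} (hd : d ≠ 0) {T : CSpace n → CSpace n}
    (hT : IsChebyshevLike Φ ω d T) : IsPolynomialMap T := by
  obtain ⟨T', hp, hT'⟩ := h.exists_isChebyshevLike hd
  rwa [h.isChebyshevLike_unique hT hT']

/-- Move from `x` in the direction iρ. Each positive root pairs nontrivially with ρ, so the
imaginary part of ⟨v, ·⟩ vanishes for one parameter only, whatever the integer `l`; finitely many
parameters are excluded in all. -/
theorem dense_compl_cartanStiefelDiagram : Dense (cartanStiefelDiagram Φ)ᶜ := by
  intro x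
  let S : Set ℝ := (fun v => -(inner ℂ (toComplex v) x).im / inner ℝ v (∑ k, ω k)) ''
    positiveRoots Φ φ
  have hS : Dense Sᶜ := (h.finite_positiveRoots.image _).countable.dense_compl ℝ
  have hcont : Continuous fun t : ℝ => x + (t * Complex.I : ℂ) • toComplex (∑ k, ω k) := by
    fun_prop
  have := map_mem_closure hcont (hS 0) (t := (cartanStiefelDiagram Φ)ᶜ) ?_
  · simpa using this
  intro t ht hmem
  obtain ⟨v, hv, l, hl⟩ := (h.mem_cartanStiefelDiagram_iff _).1 hmem
  refine ht ⟨v, hv, ?_⟩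
  rw [inner_add_right, inner_smul_right, inner_toComplex_toComplex] at hl
  have him := congrArg Complex.im hl
  simp at him
  have hpos := h.inner_sum_weight_pos hv
  rw [real_inner_comm] at hpos
  refine (div_eq_iff hpos.ne').2 ?_
  linarith

theorem exists_notMem_cartanStiefelDiagram : ∃ x, x ∉ cartanStiefelDiagram Φ :=
  h.dense_compl_cartanStiefelDiagram.nonempty

/-- The chain rule for T ∘ Ψ = Ψ ∘ (d ·), stated without division since the Weyl denominator may
vanish. -/
theorem det_fderiv_mul {d : ℕ} {T : CSpace n → CSpace n} (hT : IsChebyshevLike Φ ω d T)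
    (hdiff : Differentiable ℂ T) (x : CSpace n) :
    (fderiv ℂ T (generalizedCosine Φ ω x)).det * expEval x h.weylDenominator =
      (d : ℂ) ^ n * expEval ((d : ℂ) • x) h.weylDenominator := by
  obtain ⟨c, hc, hdet⟩ := h.exists_det_fderiv_eq
  have hΨ := differentiable_generalizedCosine (ω := ω) h.isRootSystem
  have h1 : HasFDerivAt (T ∘ generalizedCosine Φ ω) _ x :=
    (hdiff (generalizedCosine Φ ω x)).hasFDerivAt.comp x (hΨ x).hasFDerivAt
  have h2 : HasFDerivAt (generalizedCosine Φ ω ∘ fun y => (d : ℂ) • y) _ x :=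
    (hΨ ((d : ℂ) • x)).hasFDerivAt.comp x ((hasFDerivAt_id x).const_smul (d : ℂ))
  have heq : T ∘ generalizedCosine Φ ω = generalizedCosine Φ ω ∘ fun y => (d : ℂ) • y :=
    funext hT
  rw [heq] at h1
  have h3 := congrArg ContinuousLinearMap.det (h1.unique h2)
  have h4 : (fderiv ℂ (generalizedCosine Φ ω) ((d : ℂ) • x)).comp
      ((d : ℂ) • ContinuousLinearMap.id ℂ (CSpace n)) =
      (d : ℂ) • fderiv ℂ (generalizedCosine Φ ω) ((d : ℂ) • x) := by
    ext1 y
    simp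
  rw [h4] at h3
  simp only [ContinuousLinearMap.det, ContinuousLinearMap.toLinearMap_comp,
    ContinuousLinearMap.toLinearMap_smul, LinearMap.det_comp, LinearMap.det_smul] at h3
  simp only [ContinuousLinearMap.det] at hdet ⊢
  rw [hdet, hdet, finrank_euclideanSpace_fin, h.orbitJacobian_eq] at h3
  refine mul_left_cancel₀ hc ?_
  linear_combination h3

/-- The Jacobian determinant of a Chebyshev-like map, in logarithmic coordinates. -/
theorem det_fderiv_eq {d : ℕ} {T : CSpace n → CSpace n}
    (hT : IsChebyshevLike Φ ω d T) (hdiff : ContDiff ℂ 1 T) (x : CSpace n) :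
    (fderiv ℂ T (generalizedCosine Φ ω x)).det =
      (d : ℂ) ^ n * Complex.exp (2 * Real.pi * Complex.I *
          ((d - 1) * inner ℂ (toComplex (∑ k, ω k)) x)) *
        ∏ v ∈ h.finite_positiveRoots.toFinset, ∑ j ∈ Finset.range d,
          Complex.exp (2 * Real.pi * Complex.I * -inner ℂ (toComplex v) x) ^ j := by
  have hinner : ∀ v : RSpace n, Continuous fun x : CSpace n => inner ℂ (toComplex v) x :=
    fun v => (innerSL ℂ (toComplex v)).continuous
  have hdiffΨ := differentiable_generalizedCosine (ω := ω) h.isRootSystem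
  have hcont : Continuous fun x => (fderiv ℂ T (generalizedCosine Φ ω x)).det :=
    ContinuousLinearMap.continuous_det.comp
      ((hdiff.continuous_fderiv one_ne_zero).comp hdiffΨ.continuous)
  let R : CSpace n → ℂ := fun x => (d : ℂ) ^ n * Complex.exp (2 * Real.pi * Complex.I *
      ((d - 1) * inner ℂ (toComplex (∑ k, ω k)) x)) *
    ∏ v ∈ h.finite_positiveRoots.toFinset, ∑ j ∈ Finset.range d,
      Complex.exp (2 * Real.pi * Complex.I * -inner ℂ (toComplex v) x) ^ j
  suffices heq : (fun x => (fderiv ℂ T (generalizedCosine Φ ω x)).det) = R from congrFun heq x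
  -- Both sides are continuous, so it suffices to divide by the Weyl denominator on the dense set
  -- where it is nonzero; the quotients of factors are geometric sums.
  refine hcont.ext_on h.dense_compl_cartanStiefelDiagram ?_ fun x hx => ?_
  · refine (continuous_const.mul (Complex.continuous_exp.comp
      (continuous_const.mul (continuous_const.mul (hinner _))))).mul
      (continuous_finsetProd _ fun v _ => continuous_finsetSum _ fun j _ =>
        (Complex.continuous_exp.comp (continuous_const.mul (hinner v).neg)).pow j)
  · have hne : expEval x h.weylDenominator ≠ 0 := fun h0 =>
      hx ((h.expEval_weylDenominator_eq_zero_iff x).1 h0)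
    refine mul_right_cancel₀ hne ?_
    change (fderiv ℂ T (generalizedCosine Φ ω x)).det * _ = R x * _
    rw [h.det_fderiv_mul hT (hdiff.differentiable one_ne_zero), h.expEval_weylDenominator,
      h.expEval_weylDenominator]
    have hprod : ∏ v ∈ h.finite_positiveRoots.toFinset,
        (1 - Complex.exp (2 * Real.pi * Complex.I * -inner ℂ (toComplex v) ((d : ℂ) • x))) =
        (∏ v ∈ h.finite_positiveRoots.toFinset, ∑ j ∈ Finset.range d,
          Complex.exp (2 * Real.pi * Complex.I * -inner ℂ (toComplex v) x) ^ j) *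
        ∏ v ∈ h.finite_positiveRoots.toFinset,
          (1 - Complex.exp (2 * Real.pi * Complex.I * -inner ℂ (toComplex v) x)) := by
      rw [← Finset.prod_mul_distrib]
      refine Finset.prod_congr rfl fun v _ => ?_
      rw [geom_sum_mul_neg, ← Complex.exp_nat_mul, inner_smul_right]
      congr 2
      ring
    have hexp : Complex.exp (2 * Real.pi * Complex.I *
          inner ℂ (toComplex (∑ k, ω k)) ((d : ℂ) • x)) =
        Complex.exp (2 * Real.pi * Complex.I * ((d - 1) * inner ℂ (toComplex (∑ k, ω k)) x)) *
          Complex.exp (2 * Real.pi * Complex.I * inner ℂ (toComplex (∑ k, ω k)) x) := by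
      rw [← Complex.exp_add, inner_smul_right]
      congr 1
      ring
    rw [hprod, hexp]
    simp only [R]
    ring

theorem mem_criticalLocus_iff {d : ℕ} (hd : 2 ≤ d) {T : CSpace n → CSpace n}
    (hT : IsChebyshevLike Φ ω d T) (x : CSpace n) :
    generalizedCosine Φ ω x ∈ criticalLocus T ↔
      ∃ v ∈ positiveRoots Φ φ, ∃ l : ℤ,
        inner ℂ (toComplex v) ((d : ℂ) • x) = l ∧ ¬ (d : ℤ) ∣ l := by
  have hd0 : (d : ℂ) ≠ 0 := Nat.cast_ne_zero.2 (by omega)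
  have hdiff := (h.isPolynomialMap (by omega) hT).contDiff
  change (fderiv ℂ T (generalizedCosine Φ ω x)).det = 0 ↔ _
  rw [h.det_fderiv_eq hT hdiff,
    mul_eq_zero_iff_left (mul_ne_zero (pow_ne_zero _ hd0) (Complex.exp_ne_zero _)),
    Finset.prod_eq_zero_iff]
  simp only [Finite.mem_toFinset]
  refine exists_congr fun v => and_congr_right fun _ => ?_
  set w := Complex.exp (2 * Real.pi * Complex.I * -inner ℂ (toComplex v) x) with hw
  -- The geometric sum vanishes exactly at the nontrivial d-th roots of unity: d⟨v, x⟩ is integral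
  -- but ⟨v, x⟩ is not.
  have hgeom : ∑ j ∈ Finset.range d, w ^ j = 0 ↔ w ^ d = 1 ∧ w ≠ 1 := by
    constructor
    · intro h0
      refine ⟨?_, fun h1 => ?_⟩
      · have := geom_sum_mul w d
        rw [h0, zero_mul] at this
        exact (sub_eq_zero.1 this.symm)
      · simp [h1] at h0
        omega
    · rintro ⟨h1, h2⟩
      have := geom_sum_mul w d
      rw [h1, sub_self] at this
      exact (mul_eq_zero.1 this).resolve_right (sub_ne_zero.2 h2)
  rw [hgeom, hw, ← Complex.exp_nat_mul, Complex.exp_eq_one_iff, Ne, Complex.exp_eq_one_iff,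
    inner_smul_right]
  constructor
  · rintro ⟨⟨l, hl⟩, hne⟩
    have hl' : (d : ℂ) * inner ℂ (toComplex v) x = -l := by
      refine mul_left_cancel₀ Complex.two_pi_I_ne_zero ?_
      linear_combination -hl
    refine ⟨-l, by rw [hl']; push_cast; rfl, ?_⟩
    rintro ⟨m, hm⟩
    refine hne ⟨-m, ?_⟩
    have : inner ℂ (toComplex v) x = (m : ℂ) := by
      refine mul_left_cancel₀ hd0 ?_
      rw [hl']
      exact_mod_cast hm
    rw [this]
    push_cast
    ring
  · rintro ⟨l, hl, hdl⟩
    refine ⟨⟨-l, ?_⟩, ?_⟩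
    · push_cast
      linear_combination (-(2 * Real.pi * Complex.I)) * hl
    · rintro ⟨m, hm⟩
      refine hdl ⟨-m, ?_⟩
      have hm' : inner ℂ (toComplex v) x = -m := by
        refine mul_left_cancel₀ Complex.two_pi_I_ne_zero ?_
        linear_combination -hm
      rw [hm'] at hl
      exact_mod_cast hl.symm

/-- All frequencies lie in the weight lattice, hence pair integrally with every coroot. -/
theorem generalizedCosine_add_coroot {v : RSpace n} (hv : v ∈ Φ) (m : ℤ) (x : CSpace n) :
    generalizedCosine Φ ω (x + (m : ℂ) • toComplex (coroot v)) = generalizedCosine Φ ω x := by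
  ext k
  rw [generalizedCosine_apply h.isRootSystem, generalizedCosine_apply h.isRootSystem,
    expEval_weightedOrbitSum h.isRootSystem, expEval_weightedOrbitSum h.isRootSystem]
  refine Finset.sum_congr rfl fun r hr => ?_
  obtain ⟨g, hg, rfl⟩ := (weylOrbit_finite h.isRootSystem _).mem_toFinset.1 hr
  obtain ⟨l, hl⟩ := h.exists_int_inner_coroot
    (h.map_mem_weightLattice hg (h.weight_mem_weightLattice k)) hv
  congr 1
  rw [inner_add_right, inner_smul_right, inner_toComplex_toComplex, hl, mul_add, Complex.exp_add,
    mul_eq_left₀ (Complex.exp_ne_zero _), Complex.exp_eq_one_iff]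
  exact ⟨m * l, by push_cast; ring⟩

theorem postCriticalLocus_eq {d : ℕ} (hd : 2 ≤ d) {T : CSpace n → CSpace n}
    (hT : IsChebyshevLike Φ ω d T) : postCriticalLocus T = discriminantLocus Φ ω := by
  have hd0 : (d : ℂ) ≠ 0 := Nat.cast_ne_zero.2 (by omega)
  ext z
  simp only [postCriticalLocus, mem_iUnion, discriminantLocus]
  constructor
  · rintro ⟨k, hk, c, hc, rfl⟩
    obtain ⟨x, rfl⟩ := h.surjective_generalizedCosine c
    obtain ⟨v, hv, l, hl, -⟩ := (h.mem_criticalLocus_iff hd hT x).1 hc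
    obtain ⟨k, rfl⟩ := Nat.exists_eq_add_of_le' hk
    refine ⟨_, ?_, (iterate_generalizedCosine hT _ x).symm⟩
    have := natCast_smul_mem_cartanStiefelDiagram
      ((h.mem_cartanStiefelDiagram_iff ((d : ℂ) • x)).2 ⟨v, hv, l, hl⟩) (d ^ k)
    rwa [smul_smul, ← Nat.cast_mul, ← pow_succ] at this
  · rintro ⟨x, hx, rfl⟩
    obtain ⟨v, hv, l, hl⟩ := (h.mem_cartanStiefelDiagram_iff x).1 hx
    obtain ⟨m, k, a, hmk, hda⟩ := exists_add_two_mul_eq hd l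
    have hk0 : ((d ^ (k + 1) : ℕ) : ℂ) ≠ 0 := by
      rw [Nat.cast_pow]
      exact pow_ne_zero _ hd0
    -- With this choice d⟨v, y⟩ = (l + 2m)/d^k = a, which d does not divide, and d^(k+1) y differs
    -- from `x` by a coroot translation.
    let y : CSpace n := ((d ^ (k + 1) : ℕ) : ℂ)⁻¹ • (x + (m : ℂ) • toComplex (coroot v))
    refine ⟨k + 1, by omega, generalizedCosine Φ ω y, ?_, ?_⟩
    · refine (h.mem_criticalLocus_iff hd hT y).2 ⟨v, hv, a, ?_, by exact_mod_cast hda⟩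
      rw [inner_smul_right, inner_smul_right, inner_add_right, inner_smul_right,
        inner_toComplex_toComplex, inner_coroot_self (h.isRootSystem.ne_zero hv.1), hl]
      have hmk' : (l : ℂ) + 2 * m = a * (d : ℂ) ^ k := by exact_mod_cast hmk
      push_cast
      field_simp
      linear_combination (d : ℂ) * hmk'
    · rw [iterate_generalizedCosine hT, smul_inv_smul₀ hk0, h.generalizedCosine_add_coroot hv.1]

/-! ### The discriminant locus as a hypersurface, and its independence of the choice of weights. -/

theorem exists_eval_eq_zero_iff : ∃ F : MvPolynomial (Fin n) ℂ, ∀ x : CSpace n,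
    MvPolynomial.eval (fun k => generalizedCosine Φ ω x k) F = 0 ↔ x ∈ cartanStiefelDiagram Φ := by
  -- Squaring removes the sign, so the result is an invariant with the same zeros.
  obtain ⟨F, hF⟩ := h.exists_aeval_eq (f := h.weylDenominator ^ 2)
    (pow_mem h.weylDenominator_mem 2) fun i => by
      rw [map_pow, h.isometryAct_weylDenominator, neg_sq]
  refine ⟨F, fun x => ?_⟩
  rw [← expEval_aeval h.isRootSystem, hF, map_pow, sq_eq_zero_iff,
    h.expEval_weylDenominator_eq_zero_iff]

theorem exists_discriminantLocus_eq : ∃ F : MvPolynomial (Fin n) ℂ,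
    discriminantLocus Φ ω = {z | MvPolynomial.eval (fun k => z k) F = 0} := by
  obtain ⟨F, hF⟩ := h.exists_eval_eq_zero_iff
  refine ⟨F, ?_⟩
  ext z
  constructor
  · rintro ⟨x, hx, rfl⟩
    exact (hF x).2 hx
  · intro hz
    obtain ⟨x, rfl⟩ := h.surjective_generalizedCosine z
    exact ⟨x, (hF x).1 hz, rfl⟩

theorem discriminantLocus_ne_univ : discriminantLocus Φ ω ≠ univ := by
  obtain ⟨F, hF⟩ := h.exists_eval_eq_zero_iff
  obtain ⟨x, hx⟩ := h.exists_notMem_cartanStiefelDiagram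
  intro huniv
  obtain ⟨y, hy, hyx⟩ : generalizedCosine Φ ω x ∈ discriminantLocus Φ ω := huniv ▸ mem_univ _
  have := (hF y).2 hy
  rw [hyx] at this
  exact hx ((hF x).1 this)

theorem isPostCriticallyFinite {d : ℕ} (hd : 2 ≤ d) {T : CSpace n → CSpace n}
    (hT : IsChebyshevLike Φ ω d T) : IsPostCriticallyFinite T where
  holomorphic := (h.isPolynomialMap (by omega) hT).contDiff.differentiable one_ne_zero
  criticalLocus_ne_univ := by
    intro huniv
    obtain ⟨y, hy⟩ := h.exists_notMem_cartanStiefelDiagram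
    have hd0 : (d : ℂ) ≠ 0 := Nat.cast_ne_zero.2 (by omega)
    obtain ⟨v, hv, l, hl, -⟩ := (h.mem_criticalLocus_iff hd hT ((d : ℂ)⁻¹ • y)).1
      (huniv ▸ mem_univ _)
    rw [smul_inv_smul₀ hd0] at hl
    exact hy ((h.mem_cartanStiefelDiagram_iff y).2 ⟨v, hv, l, hl⟩)
  subvariety := by
    rw [h.postCriticalLocus_eq hd hT]
    obtain ⟨F, hF⟩ := h.exists_discriminantLocus_eq
    refine ⟨Ideal.span {F}, ?_⟩
    rw [hF]
    ext z
    simp only [mem_ofPred_eq, MvPolynomial.mem_zeroLocus_iff]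
    constructor
    · intro hz p hp
      obtain ⟨q, rfl⟩ := Ideal.mem_span_singleton'.1 hp
      rw [map_mul]
      exact mul_eq_zero_of_right _ hz
    · intro hz
      exact hz F (Ideal.mem_span_singleton_self F)
  proper := by
    rw [h.postCriticalLocus_eq hd hT]
    exact h.discriminantLocus_ne_univ

/-- The two families of weights have the same Weyl orbits up to enumeration, so the generalized
cosines differ by a permutation of coordinates. -/
theorem exists_perm_discriminantLocus {φ' : RSpace n →ₗ[ℝ] ℝ} {α' ω' : Fin n → RSpace n}
    (h' : IsWeightSystem Φ φ' α' ω') : ∃ σ : Equiv.Perm (Fin n),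
      discriminantLocus Φ ω' =
        LinearIsometryEquiv.piLpCongrLeft 2 ℂ ℂ σ '' discriminantLocus Φ ω := by
  obtain ⟨g, hg, σ, hσ⟩ := h.exists_perm_weight h'
  refine ⟨σ, ?_⟩
  rw [discriminantLocus, discriminantLocus, image_image]
  refine image_congr fun x _ => ?_
  ext k
  obtain ⟨k, rfl⟩ := σ.surjective k
  rw [generalizedCosine_apply h.isRootSystem, hσ]
  simp [orbitSum, weightedOrbitSum, weylOrbit_map hg, generalizedCosine_apply h.isRootSystem]

end IsWeightSystem

end ChebyshevLike

theorem mainTheorem4 {n : ℕ} (Φ : Set (ChebyshevLike.RSpace n))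
    (hΦ : ChebyshevLike.IsRootSystem Φ) :
    -- fundamental weights exist, so the assertions about every choice of them are not empty
    (∃ ω : Fin n → ChebyshevLike.RSpace n, ChebyshevLike.IsFundamentalWeights Φ ω) ∧
    ∀ ω : Fin n → ChebyshevLike.RSpace n, ChebyshevLike.IsFundamentalWeights Φ ω →
      -- the critical locus of the generalized cosine is the Cartan–Stiefel diagram
      (Differentiable ℂ (ChebyshevLike.generalizedCosine Φ ω) ∧
        ChebyshevLike.criticalLocus (ChebyshevLike.generalizedCosine Φ ω) =
          ChebyshevLike.cartanStiefelDiagram Φ) ∧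
      -- for each `d` the Chebyshev-like map is well defined, polynomial, post-critically finite,
      -- and its post-critical locus is the same set for all `d`
      (∀ d : ℕ, 2 ≤ d →
        (∃! T : ChebyshevLike.CSpace n → ChebyshevLike.CSpace n,
          ChebyshevLike.IsChebyshevLike Φ ω d T) ∧
        ∀ T : ChebyshevLike.CSpace n → ChebyshevLike.CSpace n,
          ChebyshevLike.IsChebyshevLike Φ ω d T →
            ChebyshevLike.IsPolynomialMap T ∧
            ChebyshevLike.IsPostCriticallyFinite T ∧
            ChebyshevLike.postCriticalLocus T = ChebyshevLike.discriminantLocus Φ ω) ∧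
      -- up to a permutation of the coordinates, this set does not depend on the choice of
      -- fundamental weights
      (∀ ω' : Fin n → ChebyshevLike.RSpace n, ChebyshevLike.IsFundamentalWeights Φ ω' →
        ∃ σ : Equiv.Perm (Fin n),
          ChebyshevLike.discriminantLocus Φ ω' =
            LinearIsometryEquiv.piLpCongrLeft 2 ℂ ℂ σ '' ChebyshevLike.discriminantLocus Φ ω) := by
  refine ⟨hΦ.exists_isFundamentalWeights, ?_⟩
  rintro ω ⟨φ, hφ, α, hα, hrange, hdual⟩
  have h : ChebyshevLike.IsWeightSystem Φ φ α ω := ⟨hΦ, hφ, hα, hrange, hdual⟩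
  refine ⟨⟨ChebyshevLike.differentiable_generalizedCosine hΦ,
    h.criticalLocus_generalizedCosine⟩, fun d hd => ⟨?_, fun T hT => ?_⟩, ?_⟩
  · obtain ⟨T, -, hT⟩ := h.exists_isChebyshevLike (d := d) (by omega)
    exact ⟨T, hT, fun T' hT' => h.isChebyshevLike_unique hT' hT⟩
  · exact ⟨h.isPolynomialMap (by omega) hT, h.isPostCriticallyFinite hd hT,
      h.postCriticalLocus_eq hd hT⟩
  · rintro ω' ⟨φ', hφ', α', hα', hrange', hdual'⟩
    exact h.exists_perm_discriminantLocus ⟨hΦ, hφ', hα', hrange', hdual'⟩
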